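/- **Setting.** Let $a,n\in\mathbb N$, trading dates $t_0<t_1<\dots<t_n$, bounds $\underline U^j<\overline U^j$ ($j=1,\dots,a$), $\mathcal U=\prod_{j}[\underline U^j,\overline U^j]$ and $\Omega=\mathcal U^n$ with its Borel $\sigma$-algebra. $S_{t_i}=(S^j_{t_i})_j$ is the $i$-th coordinate on $\Omega$ for $1\le i\le n$, and $S_{t_0}\in\mathcal U$ is a fixed vector. $\Omega_i\subset\mathbb R^{ia}$ is the box of possible values of $(S_{t_1},\dots,S_{t_i})$. A strategy $\Delta$ consists of constants $\Delta_0^j\in\mathbb R$ and functions $\Delta_i^j:\mathbb R^{ia}\to\mathbb R$, $1\le i\le n-1$, evaluated at $(S_{t_1},\dots,S_{t_i})$; put $\Delta_{-1}^j=\Delta_n^j=0$. For given continuous functions $T_i^j,\Lambda_i^j,D_i^j$ on $\mathbb R\times\mathbb R$ (transaction, liquidity and borrowing costs), non-negative for prices in $[\underline U^j,\overline U^j]$, let $$E_n(\Delta)=\sum_{j=1}^a\sum_{i=0}^n\big[T_i^j(S_{t_i}^j,\Delta_i^j-\Delta_{i-1}^j)+\Lambda_i^j(S_{t_i}^j,\Delta_i^j-\Delta_{i-1}^j)+D_i^j(S_{t_i}^j,\Delta_i^j)\big],$$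 $$w_{c,\Delta}=c+\sum_{j=1}^a\sum_{i=0}^{n-1}\Delta_i^j\,(S^j_{t_{i+1}}-S^j_{t_i})-E_n(\Delta).$$ Fix $B,L>0$. $W_{B,L}$ is the set of all $w_{c,\Delta}$ (parametrized by $(c,\Delta)$) such that $|c|\le B$, $|\Delta_0^j|\le B$, each $\Delta_i^j$ is $L$-Lipschitz for the Euclidean norm, and $|\Delta_i^j|\le B$ on $\Omega_i$. Let $\mathcal P$ be a finite set of Borel probability measures on $\Omega$; let $\beta:\mathbb R\to[0,\infty)$ be continuous with $\beta=0$ on $(-\infty,0]$ and $\beta>0$ on $(0,\infty)$; let $\psi:\mathbb R\to\mathbb R$ be either $x\mapsto\max(x,0)$ or continuously differentiable and not a polynomial; let $\Phi:\Omega\to\mathbb R$ be Borel measurable with $|\Phi|\le B$. For a $\sigma$-algebra $\mathcal G$ of Borel subsets of $\Omega$ and $k\in\mathbb N$ put $$\mathcal X_{B,L}(\Phi,\mathcal G)=\inf\{c:\ w_{c,\Delta}\in W_{B,L},\ \mathbb E_P[w_{c,\Delta}\mid\mathcal G]\ge\mathbb E_P[\Phi\mid\mathcal G]\ P\text{-a.s.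 for all }P\in\mathcal P\}\qquad(\inf\emptyset=+\infty),$$ $$J_{k,\mathcal G}(c,\Delta)=c+k\sum_{P\in\mathcal P}\int_\Omega\beta\big(\mathbb E_P[\Phi-w_{c,\Delta}\mid\mathcal G]\big)\,dP,\qquad \mathcal X_{B,L,k}(\Phi,\mathcal G)=\inf_{w_{c,\Delta}\in W_{B,L}}J_{k,\mathcal G}(c,\Delta),$$ and let $\mathcal X^{\mathrm{Ridge}}_{B,L,k}(\Phi,\mathcal G)$ be the infimum of $J_{k,\mathcal G}$ over those $w_{c,\Delta}\in W_{B,L}$ for which, for every $1\le i\le n-1$, the map $(\Delta_i^1,\dots,\Delta_i^a)$ coincides on $\Omega_i$ with a function of the form $x\mapsto\sum_{m=1}^N\alpha_m\,\psi(w_m\cdot x-b_m)$ ($N\in\mathbb N$, $\alpha_m\in\mathbb R^a$, $w_m\in\mathbb R^{ia}$, $b_m\in\mathbb R$) whose components are $L$-Lipschitz and bounded by $B$ on $\Omega_i$. **Random partitions.** Given $p^{(i)}\in\mathbb R^a$, $i\in\mathbb N$, let $A_i=\{x\in\mathcal U:\ p^{(i)}_j<x_j\le\overline U^j\ \text{for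 all } j\}$, let $H_i$ be the partition of $\mathcal U$ generated by $A_1,\dots,A_i$ (start from $\{\mathcal U\}$ and split every block by each new $A_i$), and let $\mathcal F_i=\{S_{t_n}^{-1}(A):A\in\sigma(H_i)\}$. Say that the partitions *generate* $\sigma(S_{t_n})$ if $\sigma(S_{t_n})=\sigma(\bigcup_i\mathcal F_i)$ up to $P$-null sets for every $P\in\mathcal P$ (that is, every set in $\sigma(S_{t_n})$ agrees up to a $P$-null set with some set in $\sigma(\bigcup_i\mathcal F_i)$; in particular this holds if the two $\sigma$-algebras are equal). Let $\mathbb P^U$ be the law under which the $p^{(i)}_j$ are independent and uniformly distributed on $[\underline U^j,\overline U^j]$. **Theorem.** 1. If $P(S^j_{t_n}=\underline U^j)=0$ for all $j$ and all $P\in\mathcal P$, then $\mathbb P^U$-a.s. the partitions generate $\sigma(S_{t_n})$. If $a=1$, then, without any condition on $\mathcal P$, $\sigma(S_{t_n})=\sigma(\bigcup_i\mathcal F_i)$ holds exactly, $\mathbb P^U$-a.s. 2. For every realization $(p^{(i)})_i$ for which the partitions generate $\sigma(S_{t_n})$, and for every $k\in\mathbb N$: the infima $\mathcal X_{B,L,k}(\Phi,\mathcal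 F_i)$, $i\in\mathbb N$, and $\mathcal X_{B,L,k}(\Phi,\sigma(S_{t_n}))$ are attained; whenever $w_{c^{(i)},\Delta^{(i)}}\in W_{B,L}$ attain $\mathcal X_{B,L,k}(\Phi,\mathcal F_i)$, there are a subsequence and some $w_{c,\Delta}\in W_{B,L}$ attaining $\mathcal X_{B,L,k}(\Phi,\sigma(S_{t_n}))$ such that along the subsequence $c^{(i)}\to c$ and $w_{c^{(i)},\Delta^{(i)}}\to w_{c,\Delta}$ uniformly on $\Omega$; and $$\lim_{i\to\infty}\mathcal X_{B,L,k}(\Phi,\mathcal F_i)=\mathcal X_{B,L,k}(\Phi,\sigma(S_{t_n})).$$ 3. For every such realization, $$\lim_{k\to\infty}\lim_{i\to\infty}\mathcal X^{\mathrm{Ridge}}_{B,L,k}(\Phi,\mathcal F_i)=\lim_{k\to\infty}\lim_{i\to\infty}\mathcal X_{B,L,k}(\Phi,\mathcal F_i)=\lim_{k\to\infty}\mathcal X_{B,L,k}(\Phi,\sigma(S_{t_n}))=\mathcal X_{B,L}(\Phi,\sigma(S_{t_n})),$$ where all the inner and outer limits exist (in $[-\infty,+\infty]$). -/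

import Mathlib

open MeasureTheory ProbabilityTheory Filter Topology
open scoped ENNReal

noncomputable section

/-- A market with `a` assets and trading dates `t_0 < t_1 < ⋯ < t_n`. The price of asset `j` stays
in `[lo j, hi j]`, the prices at `t_0` are the known numbers `spot j`, and there are continuous,
non-negative transaction, liquidity and borrowing costs for each date `t_0, …, t_n` and each asset.
A cost function takes the current price and a quantity (of shares traded or held). -/
structure Market (n a : ℕ) where
  lo : Fin a → ℝ
  hi : Fin a → ℝ
  lo_lt_hi : ∀ j, lo j < hi j
  spot : ∀ j, Set.Icc (lo j) (hi j)
  transactionCost : Fin (n + 1) → Fin a → ℝ → ℝ → ℝ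
  liquidityCost : Fin (n + 1) → Fin a → ℝ → ℝ → ℝ
  borrowingCost : Fin (n + 1) → Fin a → ℝ → ℝ → ℝ
  transactionCost_nonneg : ∀ i j, ∀ s ∈ Set.Icc (lo j) (hi j), ∀ x, 0 ≤ transactionCost i j s x
  liquidityCost_nonneg : ∀ i j, ∀ s ∈ Set.Icc (lo j) (hi j), ∀ x, 0 ≤ liquidityCost i j s x
  borrowingCost_nonneg : ∀ i j, ∀ s ∈ Set.Icc (lo j) (hi j), ∀ x, 0 ≤ borrowingCost i j s x
  transactionCost_continuous : ∀ i j, Continuous (Function.uncurry (transactionCost i j))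
  liquidityCost_continuous : ∀ i j, Continuous (Function.uncurry (liquidityCost i j))
  borrowingCost_continuous : ∀ i j, Continuous (Function.uncurry (borrowingCost i j))

/-- A trading strategy: `Δ i j` is the position in asset `j` at time `t_i`, `0 ≤ i ≤ n - 1`, as a
function on `ℝ^{ia}` of the prices at `t_1, …, t_i`. For `i = 0` the domain is the one-point space
`ℝ^0`, so that `Δ 0 j` is a constant. -/
abbrev Strategy (n a : ℕ) : Type :=
  (i : Fin n) → Fin a → EuclideanSpace ℝ (Fin i × Fin a) → ℝ

namespace Market

variable {n a : ℕ} (M : Market n a)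

/-- The price vectors at one date: `∏ j, [lo j, hi j]`. -/
abbrev Box : Type := (j : Fin a) → Set.Icc (M.lo j) (M.hi j)

/-- The price paths `Ω`, with the product (that is, Borel) sigma-algebra:
`ω i j` is the price of asset `j` at time `t_{i+1}`. -/
abbrev Path : Type := Fin n → M.Box

/-- The price vector `S_{t_i}`, `i = 0, …, n`. -/
def price (ω : M.Path) : Fin (n + 1) → M.Box :=
  Fin.cons (α := fun _ => M.Box) M.spot ω

/-- The vector `(S_{t_1}, …, S_{t_i})` in `ℝ^{ia}`. -/
def history (ω : M.Path) (i : Fin n) : EuclideanSpace ℝ (Fin i × Fin a) :=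
  WithLp.toLp 2 fun q => (ω (Fin.castLE i.isLt.le q.1) q.2 : ℝ)

/-- The box `Ω_i` in `ℝ^{ia}`. -/
def historyBox (i : ℕ) : Set (EuclideanSpace ℝ (Fin i × Fin a)) :=
  {x | ∀ q, x q ∈ Set.Icc (M.lo q.2) (M.hi q.2)}

/-- The gross trading profit `(Δ · S)_n`. -/
def gain (Δ : Strategy n a) (ω : M.Path) : ℝ :=
  ∑ j : Fin a, ∑ i : Fin n,
    Δ i j (M.history ω i) * ((M.price ω i.succ j : ℝ) - (M.price ω i.castSucc j : ℝ))

/-- The position in asset `j` held after trading at time `t_i`; it is `0` from `t_n` on. -/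
def holding (Δ : Strategy n a) (ω : M.Path) (i : ℕ) (j : Fin a) : ℝ :=
  if h : i < n then Δ ⟨i, h⟩ j (M.history ω ⟨i, h⟩) else 0

/-- The number of shares of asset `j` traded at time `t_i`; the position before `t_0` is `0`. -/
def trade (Δ : Strategy n a) (ω : M.Path) : ℕ → Fin a → ℝ
  | 0, j => M.holding Δ ω 0 j
  | i + 1, j => M.holding Δ ω (i + 1) j - M.holding Δ ω i j

/-- The total trading cost `E_n(Δ)`: transaction and liquidity costs are charged on the traded
quantity, borrowing costs on the position held. -/
def cost (Δ : Strategy n a) (ω : M.Path) : ℝ :=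
  ∑ j : Fin a, ∑ i : Fin (n + 1),
    (M.transactionCost i j (M.price ω i j) (M.trade Δ ω i j)
      + M.liquidityCost i j (M.price ω i j) (M.trade Δ ω i j)
      + M.borrowingCost i j (M.price ω i j) (M.holding Δ ω i j))

/-- The outcome `w_{c,Δ} = c + (Δ · S)_n - E_n(Δ)`. -/
def payoff (s : ℝ × Strategy n a) (ω : M.Path) : ℝ :=
  s.1 + M.gain s.2 ω - M.cost s.2 ω

/-- The parameters `(c, Δ)` of the class `W_{B,L}`. -/
def admissible (B L : ℝ) : Set (ℝ × Strategy n a) :=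
  {s | |s.1| ≤ B ∧ ∀ i j,
    (∀ x y, |s.2 i j x - s.2 i j y| ≤ L * ‖x - y‖) ∧
    (∀ x ∈ M.historyBox i, |s.2 i j x| ≤ B)}

end Market

/-- Finite linear combinations of ridge functions `x ↦ ψ (w · x - b)` from `ℝ^ι` to `ℝ^d`. -/
def IsRidge {ι : Type*} [Fintype ι] {d : ℕ} (ψ : ℝ → ℝ)
    (f : EuclideanSpace ℝ ι → Fin d → ℝ) : Prop :=
  ∃ (N : ℕ) (α : Fin N → Fin d → ℝ) (w : Fin N → EuclideanSpace ℝ ι) (b : Fin N → ℝ),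
    ∀ x l, f x l = ∑ m, α m l * ψ (inner ℝ (w m) x - b m)

namespace Market

variable {n a : ℕ} (M : Market n a)

/-- The class `Ridge_{i,B,L}`. -/
def ridge (ψ : ℝ → ℝ) (B L : ℝ) (i : ℕ) :
    Set (EuclideanSpace ℝ (Fin i × Fin a) → Fin a → ℝ) :=
  {f | IsRidge ψ f ∧ ∀ j,
    (∀ x ∈ M.historyBox i, ∀ y ∈ M.historyBox i, |f x j - f y j| ≤ L * ‖x - y‖) ∧
    (∀ x ∈ M.historyBox i, |f x j| ≤ B)}

/-- The parameters of the class `W^Ridge_{B,L}`: for `1 ≤ i ≤ n - 1` the position at time `t_i`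
is, on `Ω_i`, the restriction of an element of `Ridge_{i,B,L}`. -/
def admissibleRidge (ψ : ℝ → ℝ) (B L : ℝ) : Set (ℝ × Strategy n a) :=
  {s | s ∈ M.admissible B L ∧ ∀ i : Fin n, 0 < (i : ℕ) →
    ∃ f ∈ M.ridge ψ B L i, ∀ x ∈ M.historyBox i, ∀ j, s.2 i j x = f x j}

/-- The conditional super-replication price `X_{B,L}(Φ, 𝒢)`; the infimum over the empty set
is `+∞`. -/
def superRep (Ps : Finset (Measure M.Path)) (B L : ℝ) (Φ : M.Path → ℝ)
    (𝒢 : MeasurableSpace M.Path) : EReal :=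
  ⨅ s ∈ {s | s ∈ M.admissible B L ∧ ∀ P ∈ Ps,
    P[Φ | 𝒢] ≤ᵐ[P] P[M.payoff s | 𝒢]}, (s.1 : EReal)

/-- The objective `c + k ∑_P ∫ β (E_P[Φ - w_{c,Δ} | 𝒢]) dP`. -/
def objective (Ps : Finset (Measure M.Path)) (β : ℝ → ℝ) (k : ℕ) (Φ : M.Path → ℝ)
    (𝒢 : MeasurableSpace M.Path) (s : ℝ × Strategy n a) : ℝ :=
  s.1 + k * ∑ P ∈ Ps, ∫ ω, β ((P[Φ - M.payoff s | 𝒢]) ω) ∂P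

/-- The penalized functional `X_{B,L,k}(Φ, 𝒢)`. -/
def penalized (Ps : Finset (Measure M.Path)) (β : ℝ → ℝ) (B L : ℝ) (k : ℕ)
    (Φ : M.Path → ℝ) (𝒢 : MeasurableSpace M.Path) : EReal :=
  ⨅ s ∈ M.admissible B L, (M.objective Ps β k Φ 𝒢 s : EReal)

/-- The ridgelet-network penalized functional `X^Ridge_{B,L,k}(Φ, 𝒢)`. -/
def penalizedRidge (Ps : Finset (Measure M.Path)) (β ψ : ℝ → ℝ) (B L : ℝ) (k : ℕ)
    (Φ : M.Path → ℝ) (𝒢 : MeasurableSpace M.Path) : EReal :=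
  ⨅ s ∈ M.admissibleRidge ψ B L, (M.objective Ps β k Φ 𝒢 s : EReal)

/-- The terminal prices `S_{t_n}`. -/
def terminal (ω : M.Path) : M.Box := M.price ω (Fin.last n)

/-- The sigma-algebra `σ(S_{t_n})`. -/
@[reducible] def sigmaTerminal : MeasurableSpace M.Path :=
  MeasurableSpace.comap M.terminal inferInstance

/-- The half-open box `(p_1, q_1] × ⋯ × (p_a, q_a]`, as a subset of the space of price vectors. -/
def cell (p q : Fin a → ℝ) : Set M.Box :=
  {x | ∀ j, (x j : ℝ) ∈ Set.Ioc (p j) (q j)}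

/-- The partition `H_i` of the space of price vectors produced by the first `i` boxes
`(p i', q i']`, `i' < i`: start with one block and split every block by each new box. -/
def partition (p q : ℕ → Fin a → ℝ) : ℕ → Set (Set M.Box)
  | 0 => {Set.univ}
  | i + 1 => {C | C.Nonempty ∧ ∃ D ∈ partition p q i,
      C = D ∩ M.cell (p i) (q i) ∨ C = D \ M.cell (p i) (q i)}

/-- `F_i = {S_{t_n}⁻¹(A) : A ∈ σ(H_i)}`. -/
@[reducible] def approxSigma (p q : ℕ → Fin a → ℝ) (i : ℕ) : MeasurableSpace M.Path :=
  MeasurableSpace.comap M.terminal (MeasurableSpace.generateFrom (M.partition p q i))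

/-- `σ(⋃ i, F_i)`. -/
@[reducible] def limitSigma (p q : ℕ → Fin a → ℝ) : MeasurableSpace M.Path :=
  ⨆ i, M.approxSigma p q i

/-- `σ(S_{t_n}) = σ(⋃ i, F_i)` up to `P`-null sets, for every `P ∈ Ps`. (The inclusion `⊇` always
holds.) -/
def GeneratesTerminal (Ps : Finset (Measure M.Path)) (p q : ℕ → Fin a → ℝ) : Prop :=
  ∀ P ∈ Ps, ∀ D : Set M.Path, MeasurableSet[M.sigmaTerminal] D →
    ∃ D' : Set M.Path, MeasurableSet[M.limitSigma p q] D' ∧ D =ᵐ[P] D'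

end Market

end

/-!
The parts of the theorem rest on four facts.

*Compactness.* Payoffs depend on a strategy only through its positions on the compact boxes of price
histories. By Arzelà–Ascoli and extension of Lipschitz functions, every sequence of admissible
strategies has a subsequence whose payoffs converge uniformly to the payoff of an admissible
strategy (`Market.exists_subseq_tendsto_of_admissible`).

*Continuity.* If payoffs converge uniformly and the σ-algebras increase, then the conditional
expectations converge almost surely by Lévy's upward theorem, and the penalties converge by dominated
convergence (`tendsto_integral_comp_condExp`). σ-algebras that agree up to null sets have the same
conditional expectations, so for generating partitions the limit is the penalty for the terminal
σ-algebra (`Market.tendsto_penalty_approxSigma`). Together with compactness this is the direct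
method: minimizers exist, they converge along subsequences, and so do the minimal values. As the
weight `k` grows, the penalty of the minimizers is `O(1 / k)`, so their limit has penalty zero and
super-replicates (`Market.tendsto_penalized_superRep`).

*Density of ridge strategies.* A Lipschitz function on a box, folded onto a torus and convolved with a
trigonometric polynomial close to a positive kernel, becomes a sum of cosine ridge functions with
almost the same bound and Lipschitz constant (`exists_mem_ridgeSpan_cos`). In one variable the cosine
is a limit, together with its derivative, of sums of functions `ψ (w x - b)`: by piecewise linear
approximation for `ψ = max(·, 0)`, and otherwise because all monomials are such limits
(`cos_mem_lipClosure`). For the monomial `x ^ k` a mollification of `ψ` with a nonvanishing `k`-th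
derivative is needed; it exists, since otherwise `ψ` would be a pointwise limit of polynomials of
degree less than `k`. After scaling, ridge strategies are dense in the admissible ones, and the
penalized functional is the same for both classes (`Market.penalizedRidge_eq_penalized`).

*Generation.* Independent uniform corners are almost surely dense by the second Borel–Cantelli lemma,
and then every cell with upper corner `M.hi` is a countable union of cells of the sequence. These
cells generate the Borel sets away from the lower faces of the price box, and all Borel sets if there
is one asset (`Market.exists_measurableSet_iSup_of_dense`).
-/

/-! ### Conditional expectations along a filtration -/

/-- Nested σ-algebras that agree up to null sets have the same conditional expectations. -/
theorem condExp_ae_eq_of_forall_ae_eq {Ω : Type*} {m₁ m₂ m₀ : MeasurableSpace Ω} {μ : Measure Ω}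
    [IsFiniteMeasure μ] (h₁₂ : m₁ ≤ m₂) (h₂ : m₂ ≤ m₀)
    (h : ∀ D, MeasurableSet[m₂] D → ∃ D', MeasurableSet[m₁] D' ∧ D =ᵐ[μ] D')
    {f : Ω → ℝ} (hf : Integrable f μ) : μ[f | m₁] =ᵐ[μ] μ[f | m₂] := by
  refine ae_eq_condExp_of_forall_setIntegral_eq h₂ hf
    (fun _ _ _ => integrable_condExp.integrableOn) (fun D hD _ => ?_)
    (stronglyMeasurable_condExp.mono h₁₂).aestronglyMeasurable
  obtain ⟨D', hD', hDD'⟩ := h D hD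
  rw [setIntegral_congr_set hDD', setIntegral_congr_set hDD',
    setIntegral_condExp (h₁₂.trans h₂) hf hD']

/-- Lévy's upward theorem, with integrands that vary along a uniformly convergent sequence: the
error made by freezing the integrand is bounded by its uniform distance to the limit. -/
theorem tendsto_ae_condExp_of_tendstoUniformly {Ω : Type*} {m₀ : MeasurableSpace Ω} {μ : Measure Ω}
    [IsFiniteMeasure μ] (ℱ : Filtration ℕ m₀) {ns : ℕ → ℕ} (hns : Tendsto ns atTop atTop)
    {f : ℕ → Ω → ℝ} {g : Ω → ℝ} (hf : ∀ i, Integrable (f i) μ) (hg : Integrable g μ)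
    (hfg : TendstoUniformly f g atTop) :
    ∀ᵐ x ∂μ, Tendsto (fun i => (μ[f i | ℱ (ns i)]) x) atTop (𝓝 ((μ[g | ⨆ i, ℱ i]) x)) := by
  have hbound : ∀ᵐ x ∂μ, ∀ i m : ℕ, (∀ y, |f i y - g y| ≤ 1 / ((m : ℝ) + 1)) →
      |(μ[f i | ℱ (ns i)]) x - (μ[g | ℱ (ns i)]) x| ≤ 1 / ((m : ℝ) + 1) := by
    refine ae_all_iff.2 fun i => ae_all_iff.2 fun m => ?_
    by_cases h : ∀ y, |f i y - g y| ≤ 1 / ((m : ℝ) + 1)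
    · filter_upwards [condExp_sub (hf i) hg (ℱ (ns i)),
        ae_bdd_abs_condExp_of_ae_bdd_abs (μ := μ) (m := ℱ (ns i)) (f := f i - g)
          (Eventually.of_forall h)] with x h1 h2 _
      rw [h1] at h2
      exact h2
    · exact Eventually.of_forall fun x h' => (h h').elim
  filter_upwards [hbound, tendsto_ae_condExp (μ := μ) (ℱ := ℱ) g] with x hx hlim
  have hdiff : Tendsto (fun i => (μ[f i | ℱ (ns i)]) x - (μ[g | ℱ (ns i)]) x) atTop (𝓝 0) := by
    rw [Metric.tendsto_atTop]
    intro ε hε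
    obtain ⟨m, hm⟩ := exists_nat_one_div_lt hε
    have := Metric.tendstoUniformly_iff.1 hfg (1 / ((m : ℝ) + 1)) (by positivity)
    obtain ⟨N, hN⟩ := eventually_atTop.1 this
    refine ⟨N, fun i hi => ?_⟩
    rw [Real.dist_eq, sub_zero]
    refine (hx i m fun y => ?_).trans_lt hm
    have := (hN i hi y).le
    rwa [dist_comm, Real.dist_eq] at this
  simpa using hdiff.add (hlim.comp hns)

/-- Lévy's upward theorem combined with dominated convergence: only the limit `g` has to be bounded,
since uniform convergence bounds `f i` eventually. -/
theorem tendsto_integral_comp_condExp {Ω : Type*} {m₀ : MeasurableSpace Ω} {μ : Measure Ω}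
    [IsFiniteMeasure μ] (ℱ : Filtration ℕ m₀) {ns : ℕ → ℕ} (hns : Tendsto ns atTop atTop)
    {f : ℕ → Ω → ℝ} {g : Ω → ℝ} {β : ℝ → ℝ} (hβ : Continuous β) (hf : ∀ i, Integrable (f i) μ)
    (hg : Integrable g μ) {R : ℝ} (hgR : ∀ x, |g x| ≤ R) (hfg : TendstoUniformly f g atTop) :
    Tendsto (fun i => ∫ x, β ((μ[f i | ℱ (ns i)]) x) ∂μ) atTop
      (𝓝 (∫ x, β ((μ[g | ⨆ i, ℱ i]) x) ∂μ)) := by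
  obtain ⟨C, hC⟩ := (isCompact_Icc (a := -(R + 1)) (b := R + 1)).exists_bound_of_continuousOn
    hβ.continuousOn
  have hev : ∀ᶠ i in atTop, ∀ x, |f i x| ≤ R + 1 := by
    filter_upwards [Metric.tendstoUniformly_iff.1 hfg 1 one_pos] with i hi x
    have h1 := hi x
    rw [dist_comm, Real.dist_eq] at h1
    have h2 : |f i x| ≤ |f i x - g x| + |g x| := by simpa using abs_add_le (f i x - g x) (g x)
    linarith [hgR x]
  refine tendsto_integral_filter_of_dominated_convergence (fun _ => C) ?_ ?_ (integrable_const C) ?_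
  · exact Eventually.of_forall fun i => hβ.comp_aestronglyMeasurable
      (integrable_condExp (m := ℱ (ns i))).aestronglyMeasurable
  · filter_upwards [hev] with i hi
    filter_upwards [ae_bdd_abs_condExp_of_ae_bdd_abs (μ := μ) (m := ℱ (ns i))
      (Eventually.of_forall hi)] with x hx
    exact hC _ (abs_le.1 hx)
  · filter_upwards [tendsto_ae_condExp_of_tendstoUniformly ℱ hns hf hg hfg] with x hx
    exact (hβ.tendsto _).comp hx

theorem integrable_comp_condExp {Ω : Type*} {m m₀ : MeasurableSpace Ω} {μ : Measure Ω}
    [IsFiniteMeasure μ] {f : Ω → ℝ} {β : ℝ → ℝ} (hβ : Continuous β) {R : ℝ}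
    (hfR : ∀ x, |f x| ≤ R) : Integrable (fun x => β ((μ[f | m]) x)) μ := by
  obtain ⟨C, hC⟩ := (isCompact_Icc (a := -R) (b := R)).exists_bound_of_continuousOn hβ.continuousOn
  refine Integrable.of_bound
    (hβ.comp_aestronglyMeasurable (integrable_condExp (m := m)).aestronglyMeasurable) C ?_
  filter_upwards [ae_bdd_abs_condExp_of_ae_bdd_abs (μ := μ) (m := m)
    (Eventually.of_forall hfR)] with x hx
  exact hC _ (abs_le.1 hx)

/-! ### Payoffs and compactness of the class of strategies -/

/-- The `K`-Lipschitz functions bounded by `B` on a compact space form a compact set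
(Arzelà–Ascoli). -/
theorem isCompact_setOf_lipschitzWith_abs_le {X : Type*} [PseudoMetricSpace X]
    [CompactSpace X] (K : NNReal) (B : ℝ) :
    IsCompact {f : C(X, ℝ) | LipschitzWith K f ∧ ∀ x, |f x| ≤ B} := by
  refine ArzelaAscoli.isCompact_of_equicontinuous _ ?_
    (LipschitzWith.uniformEquicontinuous _ K fun f => f.2.1).equicontinuous
  have : ContinuousMap.toFun '' {f : C(X, ℝ) | LipschitzWith K f ∧ ∀ x, |f x| ≤ B} =
      {f : X → ℝ | LipschitzWith K f} ∩ Set.univ.pi fun _ => Set.Icc (-B) B := by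
    ext f
    constructor
    · rintro ⟨g, hg, rfl⟩
      exact ⟨hg.1, fun x _ => abs_le.1 (hg.2 x)⟩
    · rintro ⟨h1, h2⟩
      exact ⟨⟨f, h1.continuous⟩, ⟨h1, fun x => abs_le.2 (h2 x trivial)⟩, rfl⟩
  rw [this]
  exact (isCompact_univ_pi fun _ => isCompact_Icc).inter_left (isClosed_setOfPred_lipschitzWith K)

namespace Market

variable {n a : ℕ} (M : Market n a)

theorem isCompact_historyBox (i : ℕ) : IsCompact (M.historyBox i) := by
  have h : IsCompact {x : Fin i × Fin a → ℝ | ∀ q, x q ∈ Set.Icc (M.lo q.2) (M.hi q.2)} :=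
    isCompact_pi_infinite fun q => isCompact_Icc
  have h2 : M.historyBox i = (EuclideanSpace.equiv (Fin i × Fin a) ℝ).symm ''
      {x : Fin i × Fin a → ℝ | ∀ q, x q ∈ Set.Icc (M.lo q.2) (M.hi q.2)} := by
    ext x
    constructor
    · intro hx
      exact ⟨(EuclideanSpace.equiv (Fin i × Fin a) ℝ) x, hx, by simp⟩
    · rintro ⟨y, hy, rfl⟩
      exact hy
  rw [h2]
  exact h.image (EuclideanSpace.equiv (Fin i × Fin a) ℝ).symm.continuous

theorem history_mem_historyBox (ω : M.Path) (i : Fin n) : M.history ω i ∈ M.historyBox i :=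
  fun q => (ω (Fin.castLE i.isLt.le q.1) q.2).2

theorem continuous_history (i : Fin n) : Continuous fun ω : M.Path => M.history ω i := by
  unfold history
  refine (PiLp.continuous_toLp 2 _).comp ?_
  fun_prop

theorem continuous_price (i : Fin (n + 1)) (j : Fin a) :
    Continuous fun ω : M.Path => (M.price ω i j : ℝ) := by
  refine Fin.cases ?_ (fun i => ?_) i
  · simpa [price] using continuous_const
  · simp only [price, Fin.cons_succ]
    fun_prop

/-- Convergence jointly in the strategy and in the path, which on the compact path space amounts to
uniform convergence of the payoffs. -/
theorem tendsto_prod_payoff {s : ℕ → ℝ × Strategy n a} {t : ℝ × Strategy n a}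
    (hc : Tendsto (fun m => (s m).1) atTop (𝓝 t.1))
    (ht : ∀ i j, ContinuousOn (t.2 i j) (M.historyBox i))
    (hΔ : ∀ i j, TendstoUniformlyOn (fun m => (s m).2 i j) (t.2 i j) atTop (M.historyBox i))
    (ω₀ : M.Path) :
    Tendsto (fun y : ℕ × M.Path => M.payoff (s y.1) y.2) (atTop ×ˢ 𝓝 ω₀)
      (𝓝 (M.payoff t ω₀)) := by
  have hpos (i j) : Tendsto (fun y : ℕ × M.Path => (s y.1).2 i j (M.history y.2 i))
      (atTop ×ˢ 𝓝 ω₀) (𝓝 (t.2 i j (M.history ω₀ i))) := by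
    have h1 : TendstoUniformly (fun (y : ℕ × M.Path) ω => (s y.1).2 i j (M.history ω i))
        (fun ω => t.2 i j (M.history ω i)) (atTop ×ˢ 𝓝 ω₀) := fun u hu =>
      tendsto_fst.eventually ((hΔ i j u hu).mono fun m hm ω =>
        hm _ (M.history_mem_historyBox ω i))
    have h2 : Continuous fun ω => t.2 i j (M.history ω i) :=
      (ht i j).comp_continuous (M.continuous_history i) fun ω => M.history_mem_historyBox ω i
    exact h1.tendsto_comp h2.continuousAt tendsto_snd
  have hprice (i j) : Tendsto (fun y : ℕ × M.Path => (M.price y.2 i j : ℝ))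
      (atTop ×ˢ 𝓝 ω₀) (𝓝 (M.price ω₀ i j)) :=
    ((M.continuous_price i j).tendsto ω₀).comp tendsto_snd
  have hhold (i j) : Tendsto (fun y : ℕ × M.Path => M.holding (s y.1).2 y.2 i j)
      (atTop ×ˢ 𝓝 ω₀) (𝓝 (M.holding t.2 ω₀ i j)) := by
    unfold holding
    split_ifs with h
    · exact hpos ⟨i, h⟩ j
    · exact tendsto_const_nhds
  have htrade (i j) : Tendsto (fun y : ℕ × M.Path => M.trade (s y.1).2 y.2 i j)
      (atTop ×ˢ 𝓝 ω₀) (𝓝 (M.trade t.2 ω₀ i j)) := by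
    cases i with
    | zero => exact hhold 0 j
    | succ i => exact (hhold (i + 1) j).sub (hhold i j)
  refine ((hc.comp tendsto_fst).add ?_).sub ?_
  · exact tendsto_finsetSum _ fun j _ => tendsto_finsetSum _ fun i _ =>
      (hpos i j).mul ((hprice _ j).sub (hprice _ j))
  · exact tendsto_finsetSum _ fun j _ => tendsto_finsetSum _ fun i _ =>
      ((((M.transactionCost_continuous i j).tendsto (_, _)).comp
        ((hprice i j).prodMk_nhds (htrade i j))).add
      (((M.liquidityCost_continuous i j).tendsto (_, _)).comp
        ((hprice i j).prodMk_nhds (htrade i j)))).add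
      (((M.borrowingCost_continuous i j).tendsto (_, _)).comp
        ((hprice i j).prodMk_nhds (hhold i j)))

theorem continuous_payoff {t : ℝ × Strategy n a}
    (ht : ∀ i j, ContinuousOn (t.2 i j) (M.historyBox i)) : Continuous (M.payoff t) := by
  refine continuous_iff_continuousAt.2 fun ω₀ => ?_
  have h := M.tendsto_prod_payoff (s := fun _ => t) tendsto_const_nhds ht
    (fun i j u hu => Eventually.of_forall fun _ _ _ => refl_mem_uniformity hu) ω₀
  rw [ContinuousAt, ← map_snd_prod (atTop : Filter ℕ) (𝓝 ω₀)]
  exact tendsto_map'_iff.2 h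

/-- The payoff depends continuously, in the uniform topology, on the initial capital and on the
positions restricted to the boxes of possible price histories. Since path space is compact, uniform
convergence is joint convergence in the index and the path, which passes through sums, products
and continuous cost functions. -/
theorem tendstoUniformly_payoff {s : ℕ → ℝ × Strategy n a} {t : ℝ × Strategy n a}
    (hc : Tendsto (fun m => (s m).1) atTop (𝓝 t.1))
    (ht : ∀ i j, ContinuousOn (t.2 i j) (M.historyBox i))
    (hΔ : ∀ i j, TendstoUniformlyOn (fun m => (s m).2 i j) (t.2 i j) atTop (M.historyBox i)) :
    TendstoUniformly (fun m => M.payoff (s m)) (M.payoff t) atTop := by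
  rw [← tendstoLocallyUniformly_iff_tendstoUniformly_of_compactSpace,
    tendstoLocallyUniformly_iff_forall_tendsto]
  intro ω₀
  exact ((((M.continuous_payoff ht).tendsto ω₀).comp tendsto_snd).prodMk_nhds
    (M.tendsto_prod_payoff hc ht hΔ ω₀)).mono_right (nhds_le_uniformity _)

theorem lipschitzWith_of_mem_admissible {B L : ℝ} (hL : 0 ≤ L) {s : ℝ × Strategy n a}
    (hs : s ∈ M.admissible B L) (i j) : LipschitzWith ⟨L, hL⟩ (s.2 i j) :=
  LipschitzWith.of_dist_le_mul fun x y => by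
    rw [Real.dist_eq, dist_eq_norm]
    exact ((hs.2 i j).1 x y)

/-- Sequential compactness of the class of admissible strategies. A limit of positions exists on
the boxes of price histories by Arzelà–Ascoli and is extended to the whole space with the same
Lipschitz constant by McShane's formula. -/
theorem exists_subseq_tendsto_of_admissible {B L : ℝ} (hL : 0 ≤ L) {s : ℕ → ℝ × Strategy n a}
    (hs : ∀ m, s m ∈ M.admissible B L) :
    ∃ φ : ℕ → ℕ, StrictMono φ ∧ ∃ t ∈ M.admissible B L,
      Tendsto (fun m => (s (φ m)).1) atTop (𝓝 t.1) ∧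
      TendstoUniformly (fun m => M.payoff (s (φ m))) (M.payoff t) atTop := by
  have hcpt (i : ℕ) : CompactSpace (M.historyBox i) :=
    isCompact_iff_compactSpace.1 (M.isCompact_historyBox i)
  let K : Set (ℝ × ((i : Fin n) → Fin a → C(M.historyBox i, ℝ))) :=
    Set.Icc (-B) B ×ˢ Set.univ.pi fun i : Fin n => Set.univ.pi fun _ =>
      {f : C(M.historyBox i, ℝ) | LipschitzWith ⟨L, hL⟩ f ∧ ∀ x, |f x| ≤ B}
  have hK : IsCompact K := isCompact_Icc.prod (isCompact_univ_pi fun i =>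
    isCompact_univ_pi fun _ => isCompact_setOf_lipschitzWith_abs_le _ _)
  let u (m : ℕ) : ℝ × ((i : Fin n) → Fin a → C(M.historyBox i, ℝ)) :=
    ((s m).1, fun i j => ⟨(M.historyBox i).domRestrict ((s m).2 i j),
      (M.lipschitzWith_of_mem_admissible hL (hs m) i j).continuous.comp continuous_subtype_val⟩)
  have hu (m : ℕ) : u m ∈ K := ⟨abs_le.1 (hs m).1, fun i _ j _ =>
    ⟨((M.lipschitzWith_of_mem_admissible hL (hs m) i j).lipschitzOnWith).to_restrict,
      fun x => ((hs m).2 i j).2 x x.2⟩⟩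
  obtain ⟨v, hv, φ, hφ, hlim⟩ := hK.tendsto_subseq hu
  have hext (i : Fin n) (j : Fin a) : ∃ g : EuclideanSpace ℝ (Fin i × Fin a) → ℝ,
      LipschitzWith ⟨L, hL⟩ g ∧ ∀ x : M.historyBox i, v.2 i j x = g x := by
    have h := (hv.2 i trivial j trivial).1
    classical
    let f : EuclideanSpace ℝ (Fin i × Fin a) → ℝ :=
      fun x => if hx : x ∈ M.historyBox i then v.2 i j ⟨x, hx⟩ else 0
    have hf : LipschitzOnWith ⟨L, hL⟩ f (M.historyBox i) := by
      intro x hx y hy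
      simpa [f, hx, hy] using h ⟨x, hx⟩ ⟨y, hy⟩
    obtain ⟨g, hg, hfg⟩ := hf.extend_real
    exact ⟨g, hg, fun x => by rw [← hfg x.2]; simp [f]⟩
  choose g hg hvg using hext
  have hc : Tendsto (fun m => (s (φ m)).1) atTop (𝓝 v.1) := (continuous_fst.tendsto v).comp hlim
  refine ⟨φ, hφ, (v.1, g), ⟨abs_le.2 hv.1, fun i j => ⟨fun x y => ?_, fun x hx => ?_⟩⟩, hc,
    M.tendstoUniformly_payoff hc (fun i j => (hg i j).continuous.continuousOn) fun i j => ?_⟩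
  · have := (hg i j).dist_le_mul x y
    rwa [Real.dist_eq, dist_eq_norm] at this
  · have := (hv.2 i trivial j trivial).2 ⟨x, hx⟩
    rwa [hvg] at this
  · have h1 : Tendsto (fun m => (u (φ m)).2 i j) atTop (𝓝 (v.2 i j)) :=
      (((continuous_apply j).comp ((continuous_apply i).comp continuous_snd)).tendsto v).comp hlim
    have h2 := ContinuousMap.tendsto_iff_tendstoUniformly.1 h1
    rw [tendstoUniformlyOn_iff_tendstoUniformly_comp_coe]
    have h3 : g i j ∘ ((↑) : M.historyBox i → EuclideanSpace ℝ (Fin i × Fin a)) = v.2 i j :=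
      funext fun x => (hvg i j x).symm
    rw [h3]
    exact h2

end Market

/-! ### Random partitions generate the terminal σ-algebra -/

namespace Market

variable {n a : ℕ} (M : Market n a)

theorem measurable_price (i : Fin (n + 1)) : Measurable fun ω : M.Path => M.price ω i := by
  refine measurable_pi_iff.2 fun j => Measurable.subtype_mk ?_
  exact (M.continuous_price i j).measurable

theorem sigmaTerminal_le : M.sigmaTerminal ≤ MeasurableSpace.pi :=
  (M.measurable_price (Fin.last n)).comap_le

theorem measurableSet_cell (p q : Fin a → ℝ) : MeasurableSet (M.cell p q) := by
  have : M.cell p q = ⋂ j, (fun x : M.Box => (x j : ℝ)) ⁻¹' Set.Ioc (p j) (q j) := by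
    ext x; simp [cell]
  rw [this]
  exact MeasurableSet.iInter fun j =>
    (measurable_subtype_coe.comp (measurable_pi_apply j)) measurableSet_Ioc

variable (p q : ℕ → Fin a → ℝ)

theorem finite_partition (i : ℕ) : (M.partition p q i).Finite := by
  induction i with
  | zero => exact Set.finite_singleton _
  | succ i ih =>
    refine ((ih.image fun D => D ∩ M.cell (p i) (q i)).union
      (ih.image fun D => D \ M.cell (p i) (q i))).subset ?_
    rintro C ⟨-, D, hD, rfl | rfl⟩
    · exact Or.inl ⟨D, hD, rfl⟩
    · exact Or.inr ⟨D, hD, rfl⟩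

theorem exists_mem_partition (i : ℕ) (x : M.Box) : ∃ D ∈ M.partition p q i, x ∈ D := by
  induction i with
  | zero => exact ⟨Set.univ, rfl, trivial⟩
  | succ i ih =>
    obtain ⟨D, hD, hx⟩ := ih
    by_cases h : x ∈ M.cell (p i) (q i)
    · exact ⟨D ∩ M.cell (p i) (q i), ⟨⟨x, hx, h⟩, D, hD, Or.inl rfl⟩, hx, h⟩
    · exact ⟨D \ M.cell (p i) (q i), ⟨⟨x, hx, h⟩, D, hD, Or.inr rfl⟩, hx, h⟩

theorem measurableSet_generateFrom_partition_inter {i : ℕ} {D : Set M.Box}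
    (hD : D ∈ M.partition p q i) :
    MeasurableSet[.generateFrom (M.partition p q (i + 1))] (D ∩ M.cell (p i) (q i)) ∧
    MeasurableSet[.generateFrom (M.partition p q (i + 1))] (D \ M.cell (p i) (q i)) := by
  constructor
  · rcases Set.eq_empty_or_nonempty (D ∩ M.cell (p i) (q i)) with h | h
    · rw [h]; exact @MeasurableSet.empty _ (_)
    · exact MeasurableSpace.measurableSet_generateFrom ⟨h, D, hD, Or.inl rfl⟩
  · rcases Set.eq_empty_or_nonempty (D \ M.cell (p i) (q i)) with h | h
    · rw [h]; exact @MeasurableSet.empty _ (_)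
    · exact MeasurableSpace.measurableSet_generateFrom ⟨h, D, hD, Or.inr rfl⟩

theorem monotone_generateFrom_partition :
    Monotone fun i => MeasurableSpace.generateFrom (M.partition p q i) := by
  refine monotone_nat_of_le_succ fun i => MeasurableSpace.generateFrom_le fun D hD => ?_
  rw [← Set.inter_union_sdiff D (M.cell (p i) (q i))]
  have h := M.measurableSet_generateFrom_partition_inter p q hD
  exact @MeasurableSet.union _ (_) _ _ h.1 h.2

theorem measurableSet_generateFrom_partition_cell (i : ℕ) :
    MeasurableSet[.generateFrom (M.partition p q (i + 1))] (M.cell (p i) (q i)) := by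
  have : M.cell (p i) (q i) = ⋃ D ∈ M.partition p q i, D ∩ M.cell (p i) (q i) := by
    ext x
    simp only [Set.mem_iUnion, Set.mem_inter_iff, exists_prop]
    exact ⟨fun hx => (M.exists_mem_partition p q i x).imp fun D hD => ⟨hD.1, hD.2, hx⟩,
      fun ⟨D, _, _, hx⟩ => hx⟩
  rw [this]
  exact (M.finite_partition p q i).measurableSet_biUnion fun D hD =>
    (M.measurableSet_generateFrom_partition_inter p q hD).1

theorem generateFrom_partition_le (i : ℕ) :
    MeasurableSpace.generateFrom (M.partition p q i) ≤ MeasurableSpace.pi := by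
  refine MeasurableSpace.generateFrom_le ?_
  induction i with
  | zero => rintro _ rfl; exact MeasurableSet.univ
  | succ i ih =>
    rintro C ⟨-, D, hD, rfl | rfl⟩
    · exact (ih D hD).inter (M.measurableSet_cell _ _)
    · exact (ih D hD).diff (M.measurableSet_cell _ _)

theorem limitSigma_eq_comap : M.limitSigma p q =
    MeasurableSpace.comap M.terminal (⨆ i, .generateFrom (M.partition p q i)) :=
  MeasurableSpace.comap_iSup.symm

theorem approxSigma_le_sigmaTerminal (i : ℕ) : M.approxSigma p q i ≤ M.sigmaTerminal :=
  MeasurableSpace.comap_mono (M.generateFrom_partition_le p q i)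

theorem limitSigma_le_sigmaTerminal : M.limitSigma p q ≤ M.sigmaTerminal :=
  iSup_le fun i => M.approxSigma_le_sigmaTerminal p q i

/-- The σ-algebras of the successive partitions, as a filtration. -/
def approxFiltration : Filtration ℕ (MeasurableSpace.pi : MeasurableSpace M.Path) where
  seq := M.approxSigma p q
  mono' _ _ hij := MeasurableSpace.comap_mono (M.monotone_generateFrom_partition p q hij)
  le' i := (M.approxSigma_le_sigmaTerminal p q i).trans M.sigmaTerminal_le

variable {p}

/-- If the lower corners of the cells are dense in the price box, in the sense of meeting every
product of intervals `(u j, v j)` inside it, then every cell with upper corner `M.hi` belongs to the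
limit σ-algebra: it is the union of the cells of the sequence that it contains. -/
theorem measurableSet_iSup_cell
    (hp : ∀ u v : Fin a → ℝ, (∀ j, M.lo j ≤ u j ∧ u j < v j ∧ v j ≤ M.hi j) →
      ∃ i, ∀ j, u j < p i j ∧ p i j < v j)
    (u : Fin a → ℝ) (hu : ∀ j, M.lo j ≤ u j) :
    MeasurableSet[⨆ i, .generateFrom (M.partition p (fun _ => M.hi) i)] (M.cell u M.hi) := by
  have : M.cell u M.hi = ⋃ i ∈ {i | ∀ j, u j < p i j}, M.cell (p i) M.hi := by
    ext x
    simp only [cell, Set.mem_iUnion, Set.mem_Ioc, exists_prop]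
    constructor
    · intro hx
      obtain ⟨i, hi⟩ := hp u (fun j => x j) fun j => ⟨hu j, (hx j).1, (x j).2.2⟩
      exact ⟨i, fun j => (hi j).1, fun j => ⟨(hi j).2, (hx j).2⟩⟩
    · rintro ⟨i, hi, hx⟩ j
      exact ⟨(hi j).trans (hx j).1, (hx j).2⟩
  rw [this]
  refine MeasurableSet.biUnion (Set.to_countable _) fun i _ => ?_
  exact le_iSup (fun i => MeasurableSpace.generateFrom (M.partition p (fun _ => M.hi) i)) (i + 1) _
    (M.measurableSet_generateFrom_partition_cell p (fun _ => M.hi) i)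

/-- Outside the lower faces of the price box, and everywhere if there is a single asset, the limit
σ-algebra has the same traces as the Borel σ-algebra. A half-space `{x | c < x j}` agrees there with
the cell whose lower corner is `c` in coordinate `j` and the lower bound in the others. -/
theorem exists_measurableSet_iSup_of_dense
    (hp : ∀ u v : Fin a → ℝ, (∀ j, M.lo j ≤ u j ∧ u j < v j ∧ v j ≤ M.hi j) →
      ∃ i, ∀ j, u j < p i j ∧ p i j < v j)
    {A : Set M.Box} (hA : MeasurableSet A) :
    ∃ A', MeasurableSet[⨆ i, .generateFrom (M.partition p (fun _ => M.hi) i)] A' ∧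
      ∀ x : M.Box, (a = 1 ∨ ∀ j, (x j : ℝ) ≠ M.lo j) → (x ∈ A ↔ x ∈ A') := by
  set m := ⨆ i, MeasurableSpace.generateFrom (M.partition p (fun _ => M.hi) i)
  let m' : MeasurableSpace M.Box :=
    { MeasurableSet' := fun A => ∃ A', MeasurableSet[m] A' ∧
        ∀ x : M.Box, (a = 1 ∨ ∀ j, (x j : ℝ) ≠ M.lo j) → (x ∈ A ↔ x ∈ A')
      measurableSet_empty := ⟨∅, @MeasurableSet.empty _ m, fun _ _ => Iff.rfl⟩
      measurableSet_compl := fun A ⟨A', h1, h2⟩ =>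
        ⟨A'ᶜ, h1.compl, fun x hx => not_congr (h2 x hx)⟩
      measurableSet_iUnion := fun f hf => by
        choose g hg hfg using hf
        refine ⟨⋃ i, g i, MeasurableSet.iUnion hg, fun x hx => ?_⟩
        simp only [Set.mem_iUnion]
        exact exists_congr fun i => hfg i x hx }
  have hle : MeasurableSpace.pi ≤ m' := by
    refine iSup_le fun j => ?_
    have hcomap : MeasurableSpace.comap (fun x : M.Box => x j) Subtype.instMeasurableSpace =
        MeasurableSpace.comap (fun x : M.Box => (x j : ℝ)) inferInstance :=
      MeasurableSpace.comap_comp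
    refine hcomap.le.trans ?_
    rw [← measurable_iff_comap_le]
    refine measurable_of_Ioi (mδ := m') fun c => ?_
    by_cases hc : c < M.lo j
    · refine ⟨Set.univ, @MeasurableSet.univ _ m, fun x _ => ?_⟩
      simpa using hc.trans_le (x j).2.1
    · refine ⟨M.cell (Function.update M.lo j c) M.hi,
        M.measurableSet_iSup_cell hp _ fun l => ?_, fun x hx => ?_⟩
      · rcases eq_or_ne l j with rfl | hl
        · simpa using hc
        · simp [hl]
      · have hlt (l) (hl : l ≠ j) : M.lo l < x l := by
          rcases hx with rfl | hx
          · exact (hl (Subsingleton.elim _ _)).elim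
          · exact lt_of_le_of_ne (x l).2.1 (hx l).symm
        constructor
        · intro h l
          rcases eq_or_ne l j with rfl | hl
          · simpa using ⟨h, (x l).2.2⟩
          · simpa [hl] using ⟨hlt l hl, (x l).2.2⟩
        · intro h
          simpa using (h j).1
  exact hle A hA

theorem sigmaTerminal_eq_limitSigma_of_dense (ha : a = 1)
    (hp : ∀ u v : Fin a → ℝ, (∀ j, M.lo j ≤ u j ∧ u j < v j ∧ v j ≤ M.hi j) →
      ∃ i, ∀ j, u j < p i j ∧ p i j < v j) :
    M.sigmaTerminal = M.limitSigma p (fun _ => M.hi) := by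
  refine le_antisymm ?_ (M.limitSigma_le_sigmaTerminal _ _)
  rw [limitSigma_eq_comap]
  refine MeasurableSpace.comap_mono fun A hA => ?_
  obtain ⟨A', hA', h⟩ := M.exists_measurableSet_iSup_of_dense hp hA
  rwa [Set.ext fun x => h x (Or.inl ha)]

theorem generatesTerminal_of_dense
    (hp : ∀ u v : Fin a → ℝ, (∀ j, M.lo j ≤ u j ∧ u j < v j ∧ v j ≤ M.hi j) →
      ∃ i, ∀ j, u j < p i j ∧ p i j < v j)
    {Ps : Finset (Measure M.Path)}
    (hPs : ∀ P ∈ Ps, ∀ j, P {ω | (M.terminal ω j : ℝ) = M.lo j} = 0) :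
    M.GeneratesTerminal Ps p (fun _ => M.hi) := by
  rintro P hP D ⟨A, hA, rfl⟩
  obtain ⟨A', hA', h⟩ := M.exists_measurableSet_iSup_of_dense hp hA
  refine ⟨M.terminal ⁻¹' A', ?_, ?_⟩
  · rw [limitSigma_eq_comap]
    exact ⟨A', hA', rfl⟩
  · have hae : ∀ᵐ ω ∂P, ∀ j, (M.terminal ω j : ℝ) ≠ M.lo j :=
      ae_all_iff.2 fun j => by simpa [ae_iff] using hPs P hP j
    filter_upwards [hae] with ω hω
    exact propext (h _ (Or.inr hω))

/-- Independent uniform corners almost surely meet every open box inside the price box. By the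
second Borel–Cantelli lemma they meet each of the countably many rational boxes infinitely
often. -/
theorem ae_dense_of_iIndepFun_isUniform {Ξ : Type*} [MeasurableSpace Ξ] {PU : Measure Ξ}
    [IsProbabilityMeasure PU] {p : ℕ → Fin a → Ξ → ℝ}
    (hp_unif : ∀ i j, pdf.IsUniform (p i j) (Set.Icc (M.lo j) (M.hi j)) PU volume)
    (hp_indep : iIndepFun (fun q : ℕ × Fin a => p q.1 q.2) PU) :
    ∀ᵐ ξ ∂PU, ∀ u v : Fin a → ℝ, (∀ j, M.lo j ≤ u j ∧ u j < v j ∧ v j ≤ M.hi j) →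
      ∃ i, ∀ j, u j < p i j ξ ∧ p i j ξ < v j := by
  have hvol (j) : volume (Set.Icc (M.lo j) (M.hi j)) ≠ 0 := by
    simp [M.lo_lt_hi j]
  have hvol' (j) : volume (Set.Icc (M.lo j) (M.hi j)) ≠ ∞ := by simp
  have haem (i j) : AEMeasurable (p i j) PU := (hp_unif i j).aemeasurable (hvol j) (hvol' j)
  let p' (i : ℕ) (j : Fin a) : Ξ → ℝ := (haem i j).mk
  have hmeas (i j) : Measurable (p' i j) := (haem i j).measurable_mk
  have hindep : iIndepFun (fun q : ℕ × Fin a => p' q.1 q.2) PU :=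
    (iIndepFun_congr fun q : ℕ × Fin a => (haem q.1 q.2).ae_eq_mk).1 hp_indep
  have hev (u v : Fin a → ℚ) (huv : ∀ j, M.lo j ≤ u j ∧ (u j : ℝ) < v j ∧ v j ≤ M.hi j) :
      ∀ᵐ ξ ∂PU, ∃ i, ∀ j, p' i j ξ ∈ Set.Ioo (u j : ℝ) (v j) := by
    let E (i : ℕ) : Set Ξ := ⋂ j, p' i j ⁻¹' Set.Ioo (u j : ℝ) (v j)
    have hE (i) : MeasurableSet (E i) := MeasurableSet.iInter fun j => hmeas i j measurableSet_Ioo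
    have hprod (S : Finset ℕ) : PU (⋂ i ∈ S, E i) =
        ∏ i ∈ S, ∏ j, PU (p' i j ⁻¹' Set.Ioo (u j : ℝ) (v j)) := by
      have := hindep.measure_inter_preimage_eq_mul (S ×ˢ Finset.univ)
        (sets := fun q => Set.Ioo (u q.2 : ℝ) (v q.2)) fun _ _ => measurableSet_Ioo
      rw [Finset.prod_product] at this
      rw [← this]
      congr 1
      ext ξ
      simp only [E, Set.mem_iInter, Finset.mem_product]
      exact ⟨fun h q hq => h q.1 hq.1 q.2, fun h i hi j => h (i, j) ⟨hi, Finset.mem_univ _⟩⟩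
    have hE1 (i) : PU (E i) = ∏ j, PU (p' i j ⁻¹' Set.Ioo (u j : ℝ) (v j)) := by
      simpa using hprod {i}
    have hval (i j) : PU (p' i j ⁻¹' Set.Ioo (u j : ℝ) (v j)) =
        (volume (Set.Icc (M.lo j) (M.hi j)))⁻¹ * volume (Set.Ioo (u j : ℝ) (v j)) := by
      have h1 : p' i j ⁻¹' Set.Ioo (u j : ℝ) (v j) =ᵐ[PU] p i j ⁻¹' Set.Ioo (u j : ℝ) (v j) := by
        filter_upwards [(haem i j).ae_eq_mk] with ξ hξ
        change (p' i j ξ ∈ _) = (p i j ξ ∈ _)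
        rw [hξ]
      rw [measure_congr h1, (hp_unif i j).measure_preimage (hvol j) (hvol' j) measurableSet_Ioo,
        Set.inter_eq_self_of_subset_right, ENNReal.div_eq_inv_mul]
      exact Set.Ioo_subset_Icc_self.trans (Set.Icc_subset_Icc (huv j).1 (huv j).2.2)
    have hind : iIndepSet E PU := by
      rw [iIndepSet_iff_meas_biInter hE]
      intro S
      rw [hprod]
      exact Finset.prod_congr rfl fun i _ => (hE1 i).symm
    have hsum : ∑' i, PU (E i) = ∞ := by
      simp_rw [hE1, hval]
      refine ENNReal.tsum_const_eq_top_of_ne_zero ?_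
      refine Finset.prod_ne_zero_iff.2 fun j _ => mul_ne_zero ?_ ?_
      · exact ENNReal.inv_ne_zero.2 (hvol' j)
      · simpa using (huv j).2.1
    have hlim := measure_limsup_eq_one hE hind hsum
    have hlim' : ∀ᵐ ξ ∂PU, ξ ∈ limsup E atTop := by
      refine (mem_ae_iff_prob_eq_one ?_).2 hlim
      exact MeasurableSet.measurableSet_limsup hE
    filter_upwards [hlim'] with ξ hξ
    obtain ⟨i, hi⟩ := (mem_limsup_iff_frequently_mem.1 hξ).exists
    exact ⟨i, fun j => Set.mem_iInter.1 hi j⟩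
  have hall : ∀ᵐ ξ ∂PU, ∀ u v : Fin a → ℚ,
      (∀ j, M.lo j ≤ u j ∧ (u j : ℝ) < v j ∧ v j ≤ M.hi j) →
      ∃ i, ∀ j, p' i j ξ ∈ Set.Ioo (u j : ℝ) (v j) :=
    ae_all_iff.2 fun u => ae_all_iff.2 fun v => by
      by_cases huv : ∀ j, M.lo j ≤ u j ∧ (u j : ℝ) < v j ∧ v j ≤ M.hi j
      · exact (hev u v huv).mono fun _ h _ => h
      · exact Eventually.of_forall fun _ h => (huv h).elim
  have hmk : ∀ᵐ ξ ∂PU, ∀ i j, p i j ξ = p' i j ξ :=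
    ae_all_iff.2 fun i => ae_all_iff.2 fun j => (haem i j).ae_eq_mk
  filter_upwards [hall, hmk] with ξ hξ hmkξ u v huv
  choose u' hu1 hu2 using fun j => exists_rat_btwn (huv j).2.1
  choose v' hv1 hv2 using fun j => exists_rat_btwn (hu2 j)
  obtain ⟨i, hi⟩ := hξ u' v' fun j => ⟨(huv j).1.trans (hu1 j).le, hv1 j,
    (hv2 j).le.trans (huv j).2.2⟩
  refine ⟨i, fun j => ?_⟩
  rw [hmkξ]
  exact ⟨(hu1 j).trans (hi j).1, (hi j).2.trans (hv2 j)⟩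

end Market

/-! ### Approximation in the Lipschitz sense -/

/-- On the set `S`, the function `u` is bounded by `ε` and Lipschitz with constant `ε`. -/
def LipSmallOn {E : Type*} [NormedAddCommGroup E] (S : Set E) (ε : ℝ) (u : E → ℝ) : Prop :=
  (∀ x ∈ S, ∀ y ∈ S, |u x - u y| ≤ ε * ‖x - y‖) ∧ ∀ x ∈ S, |u x| ≤ ε

namespace LipSmallOn

variable {E : Type*} [NormedAddCommGroup E] {S : Set E} {ε δ : ℝ} {u v : E → ℝ}

theorem mono (hu : LipSmallOn S ε u) (h : ε ≤ δ) : LipSmallOn S δ u :=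
  ⟨fun x hx y hy => (hu.1 x hx y hy).trans (mul_le_mul_of_nonneg_right h (norm_nonneg _)),
    fun x hx => (hu.2 x hx).trans h⟩

theorem add (hu : LipSmallOn S ε u) (hv : LipSmallOn S δ v) : LipSmallOn S (ε + δ) (u + v) := by
  refine ⟨fun x hx y hy => ?_, fun x hx => ?_⟩
  · have := abs_add_le (u x - u y) (v x - v y)
    have h1 := hu.1 x hx y hy
    have h2 := hv.1 x hx y hy
    rw [add_mul, Pi.add_apply, Pi.add_apply, add_sub_add_comm]
    linarith
  · exact (abs_add_le _ _).trans (add_le_add (hu.2 x hx) (hv.2 x hx))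

theorem smul (hu : LipSmallOn S ε u) (c : ℝ) : LipSmallOn S (|c| * ε) (c • u) := by
  refine ⟨fun x hx y hy => ?_, fun x hx => ?_⟩
  · rw [Pi.smul_apply, Pi.smul_apply, ← smul_sub, smul_eq_mul, abs_mul, mul_assoc]
    exact mul_le_mul_of_nonneg_left (hu.1 x hx y hy) (abs_nonneg c)
  · rw [Pi.smul_apply, smul_eq_mul, abs_mul]
    exact mul_le_mul_of_nonneg_left (hu.2 x hx) (abs_nonneg c)

theorem of_hasDerivAt {u u' : ℝ → ℝ} {S : Set ℝ} (hS : Convex ℝ S) {ε : ℝ}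
    (hu : ∀ x ∈ S, HasDerivAt u (u' x) x) (hu' : ∀ x ∈ S, |u' x| ≤ ε) (hb : ∀ x ∈ S, |u x| ≤ ε) :
    LipSmallOn S ε u :=
  ⟨fun _ hx _ hy => hS.norm_image_sub_le_of_norm_hasDerivWithin_le
    (fun z hz => (hu z hz).hasDerivWithinAt) hu' hy hx, hb⟩

/-- On a bounded interval a small Lipschitz constant and a zero suffice. -/
theorem of_deriv {u u' : ℝ → ℝ} {R η : ℝ} {x₀ : ℝ} (hR : 0 ≤ R) (hη : 0 ≤ η)
    (hx₀ : x₀ ∈ Set.Icc (-R) R) (hu₀ : u x₀ = 0)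
    (hu : ∀ x ∈ Set.Icc (-R) R, HasDerivAt u (u' x) x)
    (hu' : ∀ x ∈ Set.Icc (-R) R, |u' x| ≤ η) :
    LipSmallOn (Set.Icc (-R) R) (η * (1 + 2 * R)) u := by
  have hlip : ∀ x ∈ Set.Icc (-R) R, ∀ y ∈ Set.Icc (-R) R, |u x - u y| ≤ η * ‖x - y‖ :=
    fun x hx y hy => (convex_Icc (-R) R).norm_image_sub_le_of_norm_hasDerivWithin_le
      (fun z hz => (hu z hz).hasDerivWithinAt) hu' hy hx
  refine ⟨fun x hx y hy => (hlip x hx y hy).trans ?_, fun x hx => ?_⟩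
  · refine mul_le_mul_of_nonneg_right ?_ (norm_nonneg _)
    nlinarith
  · have h1 := hlip x hx x₀ hx₀
    rw [hu₀, sub_zero, Real.norm_eq_abs] at h1
    have h2 : |x - x₀| ≤ 2 * R := abs_le.2 ⟨by linarith [hx.1, hx₀.2], by linarith [hx.2, hx₀.1]⟩
    nlinarith

end LipSmallOn

/-- The functions that can be approximated by elements of `V`, uniformly on `S` together with the
Lipschitz constant of the error. -/
def lipClosure {E : Type*} [NormedAddCommGroup E] (S : Set E) (V : Submodule ℝ (E → ℝ)) :
    Submodule ℝ (E → ℝ) where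
  carrier := {g | ∀ ε > 0, ∃ h ∈ V, LipSmallOn S ε (g - h)}
  zero_mem' ε hε := ⟨0, V.zero_mem, by simp [LipSmallOn, hε.le]; intros; positivity⟩
  add_mem' {g₁ g₂} h₁ h₂ ε hε := by
    obtain ⟨v₁, hv₁, hs₁⟩ := h₁ (ε / 2) (half_pos hε)
    obtain ⟨v₂, hv₂, hs₂⟩ := h₂ (ε / 2) (half_pos hε)
    refine ⟨v₁ + v₂, V.add_mem hv₁ hv₂, ?_⟩
    rw [add_sub_add_comm, ← add_halves ε]
    exact hs₁.add hs₂
  smul_mem' c g hg ε hε := by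
    obtain ⟨v, hv, hs⟩ := hg (ε / (|c| + 1)) (by positivity)
    refine ⟨c • v, V.smul_mem c hv, ?_⟩
    rw [← smul_sub]
    refine (hs.smul c).mono ?_
    rw [mul_div_assoc', div_le_iff₀ (by positivity)]
    nlinarith

theorem mem_lipClosure_of_mem {E : Type*} [NormedAddCommGroup E] (S : Set E)
    {V : Submodule ℝ (E → ℝ)} {g : E → ℝ} (hg : g ∈ V) : g ∈ lipClosure S V :=
  fun ε hε => ⟨g, hg, by simp [LipSmallOn, hε.le]; intros; positivity⟩

theorem mem_lipClosure_of_forall {E : Type*} [NormedAddCommGroup E] {S : Set E}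
    {V : Submodule ℝ (E → ℝ)} {g : E → ℝ}
    (h : ∀ ε > 0, ∃ h ∈ lipClosure S V, LipSmallOn S ε (g - h)) : g ∈ lipClosure S V := by
  intro ε hε
  obtain ⟨h₁, hm₁, hs₁⟩ := h (ε / 2) (half_pos hε)
  obtain ⟨h₂, hm₂, hs₂⟩ := hm₁ (ε / 2) (half_pos hε)
  refine ⟨h₂, hm₂, ?_⟩
  rw [← sub_add_sub_cancel g h₁ h₂, ← add_halves ε]
  exact hs₁.add hs₂

/-- The linear span of the ridge functions `x ↦ ψ (w · x - b)`. -/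
def ridgeSpan (E : Type*) [NormedAddCommGroup E] [InnerProductSpace ℝ E] (ψ : ℝ → ℝ) :
    Submodule ℝ (E → ℝ) :=
  Submodule.span ℝ (Set.range fun (p : E × ℝ) (x : E) => ψ (inner ℝ p.1 x - p.2))

theorem ridge_mem_ridgeSpan (ψ : ℝ → ℝ) (w b : ℝ) : (fun x => ψ (w * x - b)) ∈ ridgeSpan ℝ ψ :=
  Submodule.subset_span ⟨(w, b), by ext x; simp [mul_comm]⟩

/-- Piecewise linear functions approximate the cosine, together with its derivative. -/
theorem cos_mem_lipClosure_relu {ψ : ℝ → ℝ} (hψ : ∀ x, ψ x = max x 0) {R : ℝ} (hR : 0 < R) :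
    Real.cos ∈ lipClosure (Set.Icc (-R) R) (ridgeSpan ℝ ψ) := by
  have hrelu (c : ℝ) : (fun x => max (x - c) 0) ∈ ridgeSpan ℝ ψ := by
    have := ridge_mem_ridgeSpan ψ 1 c
    simpa [hψ] using this
  have hconst (c : ℝ) : (fun _ => c) ∈ ridgeSpan ℝ ψ := by
    have h1 := (ridgeSpan ℝ ψ).smul_mem c (ridge_mem_ridgeSpan ψ 0 (-1))
    convert h1 using 1
    ext x
    simp [hψ]
  -- the approximation is extended by one linear piece of length `η` at a time
  have key (η : ℝ) (hη : 0 < η) (k : ℕ) : ∃ h ∈ ridgeSpan ℝ ψ, ∃ m : ℝ,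
      (∀ x, -R + k * η ≤ x → h x = h (-R + k * η) + m * (x - (-R + k * η))) ∧
      h (-R) = Real.cos (-R) ∧
      ∀ x y, -R ≤ x → x ≤ y → y ≤ -R + k * η →
        |(Real.cos y - h y) - (Real.cos x - h x)| ≤ η * (y - x) := by
    induction k with
    | zero =>
      refine ⟨fun _ => Real.cos (-R), hconst _, 0, by simp, rfl, fun x y h1 h2 h3 => ?_⟩
      have : x = y := by simp at h3; linarith
      simp [this]
    | succ k ih =>
      obtain ⟨h, hV, m, hlin, h0, hlip⟩ := ih
      set c := -R + k * η with hc
      have hcR : -R ≤ c := by rw [hc]; linarith [mul_nonneg k.cast_nonneg hη.le]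
      have hc' : -R + ((k + 1 : ℕ) : ℝ) * η = c + η := by push_cast; ring
      rw [hc']
      have hright (x : ℝ) (hx : c ≤ x) : h x + (-Real.sin c - m) * max (x - c) 0 =
          h c + -Real.sin c * (x - c) := by
        rw [hlin x hx, max_eq_left (by linarith)]
        ring
      have hleft (x : ℝ) (hx : x ≤ c) : h x + (-Real.sin c - m) * max (x - c) 0 = h x := by
        rw [max_eq_right (by linarith)]
        ring
      refine ⟨fun x => h x + (-Real.sin c - m) * max (x - c) 0,
        (ridgeSpan ℝ ψ).add_mem hV ((ridgeSpan ℝ ψ).smul_mem _ (hrelu c)), -Real.sin c, ?_, ?_, ?_⟩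
      · intro x hx
        simp only
        rw [hright x (by linarith), hright (c + η) (by linarith)]
        ring
      · simp only
        rw [hleft _ hcR, h0]
      · have hpiece (x y : ℝ) (h1 : c ≤ x) (h2 : x ≤ y) (h3 : y ≤ c + η) :
            |(Real.cos y - (h c + -Real.sin c * (y - c))) -
              (Real.cos x - (h c + -Real.sin c * (x - c)))| ≤ η * (y - x) := by
          have hd (z : ℝ) (_ : z ∈ Set.Icc c (c + η)) : HasDerivWithinAt
              (fun z => Real.cos z - (h c + -Real.sin c * (z - c)))
              (-Real.sin z - (-Real.sin c * 1)) (Set.Icc c (c + η)) z :=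
            ((Real.hasDerivAt_cos z).sub
              ((((hasDerivAt_id z).sub_const c).const_mul (-Real.sin c)).const_add
                (h c))).hasDerivWithinAt
          have hb (z : ℝ) (hz : z ∈ Set.Icc c (c + η)) : ‖-Real.sin z - (-Real.sin c * 1)‖ ≤ η := by
            have h4 : |Real.sin c - Real.sin z| ≤ |c - z| := by
              have := Real.lipschitzWith_sin.dist_le_mul c z
              simpa [Real.dist_eq] using this
            have h5 : |c - z| ≤ η := abs_le.2 ⟨by linarith [hz.2], by linarith [hz.1]⟩
            rw [Real.norm_eq_abs, show -Real.sin z - (-Real.sin c * 1) =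
              Real.sin c - Real.sin z by ring]
            exact h4.trans h5
          have := (convex_Icc c (c + η)).norm_image_sub_le_of_norm_hasDerivWithin_le hd hb
            ⟨h1, h2.trans h3⟩ ⟨h1.trans h2, h3⟩
          rwa [Real.norm_eq_abs, Real.norm_eq_abs, abs_of_nonneg (sub_nonneg.2 h2)] at this
        intro x y h1 h2 h3
        simp only
        rcases le_total y c with hy | hy
        · rw [hleft y hy, hleft x (h2.trans hy)]
          exact hlip x y h1 h2 hy
        · rw [hright y hy]
          rcases le_total x c with hx | hx
          · rw [hleft x hx]
            have e1 := hlip x c h1 hx le_rfl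
            have e2 := hpiece c y le_rfl hy h3
            rw [sub_self, mul_zero, add_zero] at e2
            calc _ ≤ _ := abs_sub_le _ (Real.cos c - h c) _
              _ ≤ η * (y - x) := by linarith
          · rw [hright x hx]
            exact hpiece x y hx h2 h3
  intro ε hε
  obtain ⟨η, hη, hηε⟩ : ∃ η > 0, η * (1 + 2 * R) ≤ ε :=
    ⟨ε / (1 + 2 * R), by positivity, by rw [div_mul_cancel₀ _ (by positivity)]⟩
  obtain ⟨k, hk⟩ := exists_nat_ge (2 * R / η)
  rw [div_le_iff₀ hη] at hk
  obtain ⟨h, hV, m, -, h0, hlip⟩ := key η hη k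
  have hlip' : ∀ x ∈ Set.Icc (-R) R, ∀ y ∈ Set.Icc (-R) R,
      |(Real.cos x - h x) - (Real.cos y - h y)| ≤ η * |x - y| := by
    intro x hx y hy
    rcases le_total x y with hxy | hxy
    · rw [abs_sub_comm, abs_sub_comm x y, abs_of_nonneg (sub_nonneg.2 hxy)]
      exact hlip x y hx.1 hxy (by linarith [hy.2])
    · rw [abs_of_nonneg (sub_nonneg.2 hxy)]
      exact hlip y x hy.1 hxy (by linarith [hx.2])
  refine ⟨h, hV, fun x hx y hy => (hlip' x hx y hy).trans ?_, fun x hx => ?_⟩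
  · exact mul_le_mul_of_nonneg_right (by nlinarith) (abs_nonneg _)
  · have h1 := hlip' x hx (-R) ⟨le_rfl, by linarith⟩
    rw [h0, sub_self, sub_zero, abs_of_nonneg (by linarith [hx.1] : 0 ≤ x - -R)] at h1
    refine h1.trans (le_trans ?_ hηε)
    exact mul_le_mul_of_nonneg_left (by linarith [hx.2]) hη.le

/-! ### Polynomials, smooth functions and Riemann sums -/

theorem Polynomial.exists_derivative_eq (p : Polynomial ℝ) {k : ℕ} (hp : p.degree < k) :
    ∃ q : Polynomial ℝ, q.derivative = p ∧ q.degree < (k + 1 : ℕ) := by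
  refine ⟨∑ i ∈ Finset.range k, C (p.coeff i / (i + 1)) * X ^ (i + 1), ?_, ?_⟩
  · have h (i : ℕ) : derivative (C (p.coeff i / (i + 1)) * X ^ (i + 1)) =
        C (p.coeff i) * X ^ i := by
      rw [derivative_C_mul_X_pow]
      congr 2
      push_cast
      field_simp
    ext l
    simp_rw [derivative_sum, h, finsetSum_coeff, coeff_C_mul_X_pow]
    rw [Finset.sum_ite_eq]
    simp only [Finset.mem_range]
    split_ifs with hl
    · rfl
    · exact (coeff_eq_zero_of_degree_lt (hp.trans_le (by exact_mod_cast not_lt.1 hl))).symm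
  · rw [← mem_degreeLT]
    refine Submodule.sum_mem _ fun i hi => mem_degreeLT.2 ?_
    refine (degree_C_mul_X_pow_le _ _).trans_lt ?_
    exact_mod_cast Nat.succ_lt_succ (Finset.mem_range.1 hi)

theorem exists_polynomial_of_iteratedDeriv_eq_zero {k : ℕ} : ∀ {g : ℝ → ℝ}, ContDiff ℝ k g →
    (∀ x, iteratedDeriv k g x = 0) →
    ∃ p : Polynomial ℝ, p.degree < k ∧ ∀ x, g x = p.eval x := by
  induction k with
  | zero => exact fun {g} _ h => ⟨0, by simp, fun x => by simpa using h x⟩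
  | succ k ih =>
    intro g hg h
    have hg' : ContDiff ℝ k (deriv g) := by
      have := (contDiff_succ_iff_deriv (n := (k : WithTop ℕ∞))).1 (by exact_mod_cast hg)
      exact this.2.2
    have hd : Differentiable ℝ g := hg.differentiable (by simp)
    obtain ⟨p, hp, hgp⟩ := ih hg' fun x => by rw [← iteratedDeriv_succ']; exact h x
    obtain ⟨q, hq, hqk⟩ := p.exists_derivative_eq hp
    refine ⟨q + Polynomial.C (g 0 - q.eval 0), ?_, fun x => ?_⟩
    · refine (Polynomial.degree_add_le _ _).trans_lt (max_lt hqk ?_)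
      refine Polynomial.degree_C_le.trans_lt ?_
      exact_mod_cast Nat.succ_pos k
    · have hconst := is_const_of_deriv_eq_zero (f := fun x => g x - q.eval x)
        (hd.sub q.differentiable) (fun x => by
          rw [deriv_fun_sub (hd x) q.differentiableAt, hgp, Polynomial.deriv, hq, sub_self]) x 0
      simp [← hconst]

/-- Polynomials of degree less than `k` are closed under pointwise limits, by Lagrange
interpolation. -/
theorem exists_polynomial_of_tendsto {k : ℕ} {p : ℕ → Polynomial ℝ} (hp : ∀ i, (p i).degree < k)
    {g : ℝ → ℝ} (hg : ∀ x, Tendsto (fun i => (p i).eval x) atTop (𝓝 (g x))) :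
    ∃ Q : Polynomial ℝ, ∀ x, g x = Q.eval x := by
  have hv : Set.InjOn (fun i : ℕ => (i : ℝ)) (Finset.range k : Set ℕ) :=
    Nat.cast_injective.injOn
  refine ⟨Lagrange.interpolate (Finset.range k) (fun i : ℕ => (i : ℝ)) fun i => g i, fun x => ?_⟩
  refine tendsto_nhds_unique (hg x) ?_
  have h (i : ℕ) : (p i).eval x =
      ∑ l ∈ Finset.range k, (p i).eval (l : ℝ) *
        (Lagrange.basis (Finset.range k) (fun i : ℕ => (i : ℝ)) l).eval x := by
    have := congrArg (Polynomial.eval x)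
      (Lagrange.eq_interpolate hv (f := p i) (by simpa using hp i))
    simpa [Lagrange.interpolate_apply, Polynomial.eval_finsetSum] using this
  simp_rw [h]
  simp only [Lagrange.interpolate_apply, Polynomial.eval_finsetSum, Polynomial.eval_mul,
    Polynomial.eval_C]
  exact tendsto_finsetSum _ fun l _ => (hg l).mul_const _

/-- If all dilates of a smooth function `f` can be approximated, then so can every monomial `x ^ k`
for which the `k`-th derivative of `f` at `0` does not vanish: it is the leading term of the
Taylor expansion of `f (w x)` as `w → 0`, after removing the lower monomials. -/
theorem pow_mem_lipClosure_of_iteratedDeriv_ne_zero {V : Submodule ℝ (ℝ → ℝ)} {R : ℝ} (hR : 0 < R)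
    {f : ℝ → ℝ} {k : ℕ} (hf : ContDiff ℝ k f)
    (hV : ∀ w, (fun x => f (w * x)) ∈ lipClosure (Set.Icc (-R) R) V)
    (hlow : ∀ m < k, (fun x : ℝ => x ^ m) ∈ lipClosure (Set.Icc (-R) R) V)
    (hk : iteratedDeriv k f 0 ≠ 0) : (fun x : ℝ => x ^ k) ∈ lipClosure (Set.Icc (-R) R) V := by
  cases k with
  | zero =>
    have h := (lipClosure (Set.Icc (-R) R) V).smul_mem (f 0)⁻¹ (hV 0)
    convert h using 1
    ext x
    have : f 0 ≠ 0 := by simpa using hk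
    simp [this]
  | succ K =>
    have hf' : ContDiff ℝ K (deriv f) := by
      have := (contDiff_succ_iff_deriv (n := (K : WithTop ℕ∞))).1 (by exact_mod_cast hf)
      exact this.2.2
    have hd : Differentiable ℝ f := hf.differentiable (by simp)
    set a : ℝ := (((K : ℝ) + 1) * (K.factorial : ℝ))⁻¹ * iteratedDeriv (K + 1) f 0 with ha
    have ha0 : a ≠ 0 := mul_ne_zero (by positivity) hk
    have htaylor (x : ℝ) : taylorWithinEval f (K + 1) Set.univ 0 x =
        taylorWithinEval f K Set.univ 0 x + a * x ^ (K + 1) := by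
      rw [taylorWithinEval_succ, iteratedDerivWithin_univ, ha, sub_zero, smul_eq_mul]
      ring
    let u (x : ℝ) := f x - taylorWithinEval f (K + 1) Set.univ 0 x
    let u' (x : ℝ) := deriv f x - taylorWithinEval (deriv f) K Set.univ 0 x
    have hu (x : ℝ) : HasDerivAt u (u' x) x := by
      have := hasDerivAt_taylorWithinEval_succ (x₀ := 0) (x := x) (s := Set.univ) f K
      rw [derivWithin_univ] at this
      exact (hd x).hasDerivAt.sub this
    have hu0 : u 0 = 0 := by simp [u]
    have ho := taylor_isLittleO_univ (x₀ := 0) hf'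
    refine mem_lipClosure_of_forall fun ε hε => ?_
    set c := ε * |a| / (R ^ K * (1 + 2 * R)) with hc
    have ha' : 0 < |a| := abs_pos.2 ha0
    have hcpos : 0 < c := by positivity
    obtain ⟨δ, hδ, hbound⟩ := Metric.eventually_nhds_iff.1 (ho.def hcpos)
    obtain ⟨w, hw, hwR⟩ : ∃ w > 0, w * R < δ :=
      ⟨δ / (2 * R), by positivity, by field_simp; norm_num⟩
    refine ⟨fun x => a⁻¹ * (w ^ (K + 1))⁻¹ * (f (w * x) - taylorWithinEval f K Set.univ 0 (w * x)),
      ?_, ?_⟩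
    · refine (lipClosure (Set.Icc (-R) R) V).smul_mem (a⁻¹ * (w ^ (K + 1))⁻¹)
        ((lipClosure (Set.Icc (-R) R) V).sub_mem (hV w) ?_)
      have : (fun x => taylorWithinEval f K Set.univ 0 (w * x)) =
          ∑ m ∈ Finset.range (K + 1), ((m.factorial : ℝ)⁻¹ * w ^ m *
            iteratedDerivWithin m f Set.univ 0) • fun x : ℝ => x ^ m := by
        ext x
        rw [taylor_within_apply, Finset.sum_apply]
        refine Finset.sum_congr rfl fun m _ => ?_
        simp only [sub_zero, mul_pow, smul_eq_mul, Pi.smul_apply]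
        ring
      rw [this]
      exact Submodule.sum_mem _ fun m hm =>
        Submodule.smul_mem _ _ (hlow m (Finset.mem_range.1 hm))
    · have herr : ((fun x : ℝ => x ^ (K + 1)) - fun x => a⁻¹ * (w ^ (K + 1))⁻¹ *
          (f (w * x) - taylorWithinEval f K Set.univ 0 (w * x))) =
          fun x => -(a⁻¹ * (w ^ (K + 1))⁻¹) * u (w * x) := by
        ext x
        simp only [u, Pi.sub_apply, htaylor]
        field_simp
        ring
      rw [herr]
      have hmul : ε = |a|⁻¹ * c * R ^ K * (1 + 2 * R) := by
        rw [hc]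
        field_simp
      rw [hmul]
      refine LipSmallOn.of_deriv (x₀ := 0) (u' := fun x => -(a⁻¹ * (w ^ (K + 1))⁻¹) *
        (u' (w * x) * (w * 1))) hR.le (by positivity) ⟨by linarith, hR.le⟩ (by simp [hu0])
        (fun x _ => ?_) fun x hx => ?_
      · exact ((hu (w * x)).comp x ((hasDerivAt_id x).const_mul w)).const_mul _
      · have hxR : |x| ≤ R := abs_le.2 hx
        have hwx : |w * x| < δ := by
          rw [abs_mul, abs_of_pos hw]
          exact (mul_le_mul_of_nonneg_left hxR hw.le).trans_lt hwR
        have h1 : |u' (w * x)| ≤ c * (w ^ K * R ^ K) := by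
          have := hbound (y := w * x) (by simpa using hwx)
          rw [sub_zero, Real.norm_eq_abs, norm_pow, Real.norm_eq_abs, abs_mul, abs_of_pos hw,
            mul_pow] at this
          exact this.trans (by gcongr)
        rw [abs_mul, abs_mul, abs_neg, abs_mul, abs_inv, abs_inv, abs_pow, mul_one, abs_of_pos hw]
        calc |a|⁻¹ * (w ^ (K + 1))⁻¹ * (|u' (w * x)| * w)
            ≤ |a|⁻¹ * (w ^ (K + 1))⁻¹ * (c * (w ^ K * R ^ K) * w) := by gcongr
          _ = |a|⁻¹ * c * R ^ K := by field_simp; ring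

/-- Weierstrass' theorem applied to the derivative `-sin`, followed by integration, approximates `cos`
by polynomials together with its derivative. -/
theorem cos_mem_lipClosure_of_pow_mem {V : Submodule ℝ (ℝ → ℝ)} {R : ℝ} (hR : 0 < R)
    (h : ∀ k : ℕ, (fun x : ℝ => x ^ k) ∈ lipClosure (Set.Icc (-R) R) V) :
    Real.cos ∈ lipClosure (Set.Icc (-R) R) V := by
  refine mem_lipClosure_of_forall fun ε hε => ?_
  obtain ⟨p, hp⟩ := exists_polynomial_near_of_continuousOn (-R) R (fun x => -Real.sin x)
    (by fun_prop) (ε / (1 + 2 * R)) (by positivity)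
  obtain ⟨q, hq, -⟩ := p.exists_derivative_eq (k := p.natDegree + 1)
    (Polynomial.degree_le_natDegree.trans_lt (by exact_mod_cast Nat.lt_succ_self _))
  set P := q + Polynomial.C (1 - q.eval 0) with hP
  refine ⟨fun x => P.eval x, ?_, ?_⟩
  · have : (fun x => P.eval x) =
        ∑ m ∈ Finset.range (P.natDegree + 1), P.coeff m • fun x : ℝ => x ^ m := by
      ext x
      simp [Polynomial.eval_eq_sum_range]
    rw [this]
    exact Submodule.sum_mem _ fun m _ => Submodule.smul_mem _ _ (h m)
  · have hε' : ε = ε / (1 + 2 * R) * (1 + 2 * R) := by field_simp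
    rw [hε']
    refine LipSmallOn.of_deriv (x₀ := 0) (u' := fun x => -Real.sin x - p.eval x) hR.le
      (by positivity) ⟨by linarith, hR.le⟩ (by simp [hP]) (fun x _ => ?_) fun x hx => ?_
    · have hP' : P.derivative = p := by simp [hP, hq]
      rw [← hP']
      exact (Real.hasDerivAt_cos x).sub (P.hasDerivAt x)
    · rw [abs_sub_comm]
      exact (hp x hx).le

/-- Error of the Riemann sum of `k` with respect to the signed weight `φ` on a grid of `N` cells, where
`k` oscillates by at most `η` on each cell. -/
theorem abs_integral_mul_sub_sum_le {φ k : ℝ → ℝ} (hφ : Continuous φ) (hk : Continuous k) {A η : ℝ}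
    (hA : 0 < A) {N : ℕ} (hN : 0 < N)
    (h : ∀ s ∈ Set.Icc (-A) A, ∀ s' ∈ Set.Icc (-A) A, |s - s'| ≤ 2 * A / N → |k s - k s'| ≤ η) :
    |(∫ s in (-A)..A, φ s * k s) - ∑ i ∈ Finset.range N,
      (∫ s in (-A + i * (2 * A / N))..(-A + (i + 1 : ℕ) * (2 * A / N)), φ s) *
        k (-A + i * (2 * A / N))| ≤ (∫ s in (-A)..A, |φ s|) * η := by
  have hN' : (0 : ℝ) < N := by exact_mod_cast hN
  set δ := 2 * A / N with hδ
  have hδ0 : 0 < δ := by positivity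
  have hNδ : N * δ = 2 * A := by rw [hδ]; field_simp
  let t (i : ℕ) : ℝ := -A + i * δ
  have ht0 : t 0 = -A := by simp [t]
  have htN : t N = A := by simp only [t, hNδ]; ring
  have htle (i : ℕ) : t i ≤ t (i + 1) := by simp only [t]; push_cast; nlinarith
  have hmono : Monotone t := monotone_nat_of_le_succ htle
  have hstep (i : ℕ) : t (i + 1) - t i = δ := by simp only [t]; push_cast; ring
  have hφk : Continuous fun s => φ s * k s := hφ.mul hk
  have hφabs : Continuous fun s => |φ s| := hφ.abs
  have e1 : ∫ s in (-A)..A, φ s * k s =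
      ∑ i ∈ Finset.range N, ∫ s in t i..t (i + 1), φ s * k s := by
    rw [intervalIntegral.sum_integral_adjacent_intervals
      fun i _ => hφk.intervalIntegrable _ _, ht0, htN]
  have e2 : ∫ s in (-A)..A, |φ s| = ∑ i ∈ Finset.range N, ∫ s in t i..t (i + 1), |φ s| := by
    rw [intervalIntegral.sum_integral_adjacent_intervals
      fun i _ => hφabs.intervalIntegrable _ _, ht0, htN]
  rw [e1, e2, ← Finset.sum_sub_distrib, Finset.sum_mul]
  refine (Finset.abs_sum_le_sum_abs _ _).trans (Finset.sum_le_sum fun i hi => ?_)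
  have hi' : i + 1 ≤ N := Finset.mem_range.1 hi
  have hI : Set.Icc (t i) (t (i + 1)) ⊆ Set.Icc (-A) A :=
    Set.Icc_subset_Icc (ht0 ▸ hmono (Nat.zero_le i)) (htN ▸ hmono hi')
  have hφc : Continuous fun s => φ s * k (t i) := hφ.mul continuous_const
  have hφη : Continuous fun s => |φ s| * η := hφabs.mul continuous_const
  change |(∫ s in t i..t (i + 1), φ s * k s) - (∫ s in t i..t (i + 1), φ s) * k (t i)| ≤ _
  rw [← intervalIntegral.integral_mul_const, ← intervalIntegral.integral_mul_const,
    ← intervalIntegral.integral_sub (hφk.intervalIntegrable _ _)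
      (hφc.intervalIntegrable _ _)]
  rw [← Real.norm_eq_abs]
  refine intervalIntegral.norm_integral_le_of_norm_le (htle i) ?_
    (hφη.intervalIntegrable _ _)
  refine Eventually.of_forall fun s hs => ?_
  have hs' : s ∈ Set.Icc (t i) (t (i + 1)) := Set.Ioc_subset_Icc_self hs
  rw [← mul_sub, norm_mul]
  refine mul_le_mul_of_nonneg_left (h s (hI hs') _ (hI ⟨le_rfl, htle i⟩) ?_) (abs_nonneg _)
  rw [abs_of_nonneg (by linarith [hs'.1])]
  linarith [hs'.2, hstep i]

/-- Integrals of a family that is continuous in the Lipschitz sense are limits of Riemann sums in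
the same sense. -/
theorem integral_mem_lipClosure {E : Type*} [NormedAddCommGroup E] {S : Set E}
    {V : Submodule ℝ (E → ℝ)} {κ : ℝ → E → ℝ} {φ : ℝ → ℝ} (hφ : Continuous φ) {A : ℝ} (hA : 0 < A)
    (hκ : ∀ x, Continuous fun s => κ s x) (hmem : ∀ s, κ s ∈ lipClosure S V)
    (hcont : ∀ ε > 0, ∃ δ > 0, ∀ s ∈ Set.Icc (-A) A, ∀ s' ∈ Set.Icc (-A) A, |s - s'| ≤ δ →
      LipSmallOn S ε (κ s - κ s')) :
    (fun x => ∫ s in (-A)..A, φ s * κ s x) ∈ lipClosure S V := by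
  refine mem_lipClosure_of_forall fun ε hε => ?_
  set C := ∫ s in (-A)..A, |φ s|
  have hC : 0 ≤ C := intervalIntegral.integral_nonneg (by linarith) fun s _ => abs_nonneg _
  set η := ε / (C + 1) with hη
  have hη0 : 0 < η := by positivity
  have hCη : C * η ≤ ε := by
    rw [hη, mul_div_assoc', div_le_iff₀ (by positivity)]
    nlinarith
  obtain ⟨δ, hδ, hs⟩ := hcont η hη0
  obtain ⟨N, hN⟩ := exists_nat_ge (2 * A / δ)
  have hN0 : 0 < N := by
    have : (0 : ℝ) < N := lt_of_lt_of_le (by positivity) hN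
    exact_mod_cast this
  have hN' : 2 * A / N ≤ δ := by
    have : (0 : ℝ) < N := by exact_mod_cast hN0
    rw [div_le_iff₀ hδ] at hN
    rw [div_le_iff₀ this]
    linarith
  refine ⟨∑ i ∈ Finset.range N,
    (∫ s in (-A + i * (2 * A / N))..(-A + (i + 1 : ℕ) * (2 * A / N)), φ s) •
      κ (-A + i * (2 * A / N)), Submodule.sum_mem _ fun i _ => Submodule.smul_mem _ _ (hmem _),
    fun x hx y hy => ?_, fun x hx => ?_⟩
  · have := abs_integral_mul_sub_sum_le hφ (k := fun s => κ s x - κ s y) ((hκ x).sub (hκ y))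
      (η := η * ‖x - y‖) hA hN0
      fun s h1 s' h2 h3 => by
        have := (hs s h1 s' h2 (h3.trans hN')).1 x hx y hy
        simp only [Pi.sub_apply] at this
        convert this using 2
        ring
    simp only [mul_sub, Finset.sum_sub_distrib] at this
    have hint (z : E) : IntervalIntegrable (fun s => φ s * κ s z) volume (-A) A :=
      Continuous.intervalIntegrable (hφ.mul (hκ z)) _ _
    rw [intervalIntegral.integral_sub (hint x) (hint y), sub_sub_sub_comm] at this
    simp only [Pi.sub_apply, Finset.sum_apply, Pi.smul_apply, smul_eq_mul]
    refine this.trans ?_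
    rw [← mul_assoc]
    exact mul_le_mul_of_nonneg_right hCη (norm_nonneg _)
  · have := abs_integral_mul_sub_sum_le hφ (hκ x) (η := η) hA hN0
      fun s h1 s' h2 h3 => (hs s h1 s' h2 (h3.trans hN')).2 x hx
    simp only [Pi.sub_apply, Finset.sum_apply, Pi.smul_apply, smul_eq_mul]
    exact this.trans hCη

/-! ### Universal approximation of the cosine -/

/-- Averages of the translates of a `C¹` function are limits of linear combinations of these
translates, by uniform continuity of the function and its derivative on bounded sets. -/
theorem integral_comp_mem_lipClosure {ψ : ℝ → ℝ} (hψ : ContDiff ℝ 1 ψ) {φ : ℝ → ℝ}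
    (hφ : Continuous φ) {A R : ℝ} (hA : 0 < A) (w b : ℝ) :
    (fun x => ∫ s in (-A)..A, φ s * ψ (w * x - b - s)) ∈
      lipClosure (Set.Icc (-R) R) (ridgeSpan ℝ ψ) := by
  refine integral_mem_lipClosure (κ := fun s x => ψ (w * x - b - s)) hφ hA
    (fun x => hψ.continuous.comp (by fun_prop)) (fun s => ?_) fun ε hε => ?_
  · refine mem_lipClosure_of_mem _ ?_
    simp_rw [sub_sub]
    exact ridge_mem_ridgeSpan ψ w (b + s)
  · set Q := |w| * R + |b| + A
    have huc {g : ℝ → ℝ} (hg : Continuous g) {η : ℝ} (hη : 0 < η) : ∃ δ > 0,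
        ∀ x ∈ Set.Icc (-Q) Q, ∀ y ∈ Set.Icc (-Q) Q, |x - y| < δ → |g x - g y| < η := by
      have := Metric.uniformContinuousOn_iff.1
        (isCompact_Icc.uniformContinuousOn_of_continuous (s := Set.Icc (-Q) Q) hg.continuousOn) η hη
      simpa only [Real.dist_eq] using this
    obtain ⟨δ₁, hδ₁, h₁⟩ := huc hψ.continuous hε
    have hψ' : Continuous (deriv ψ) := hψ.continuous_deriv le_rfl
    obtain ⟨δ₂, hδ₂, h₂⟩ := huc hψ' (η := ε / (|w| + 1)) (by positivity)
    refine ⟨min δ₁ δ₂ / 2, by positivity, fun s hs s' hs' hss' => ?_⟩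
    have hlt : |s - s'| < min δ₁ δ₂ := hss'.trans_lt (half_lt_self (by positivity))
    have hmem (x) (hx : x ∈ Set.Icc (-R) R) (s) (hs : s ∈ Set.Icc (-A) A) :
        w * x - b - s ∈ Set.Icc (-Q) Q := by
      refine abs_le.1 ?_
      have e1 := abs_sub (w * x - b) s
      have e2 := abs_sub (w * x) b
      have e3 : |w * x| ≤ |w| * R := by
        rw [abs_mul]
        exact mul_le_mul_of_nonneg_left (abs_le.2 hx) (abs_nonneg _)
      have e4 : |s| ≤ A := abs_le.2 hs
      linarith
    have hdist (x : ℝ) : |(w * x - b - s) - (w * x - b - s')| = |s - s'| := by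
      rw [sub_sub_sub_cancel_left, abs_sub_comm]
    refine LipSmallOn.of_hasDerivAt (convex_Icc _ _)
      (u' := fun x => deriv ψ (w * x - b - s) * (w * 1) - deriv ψ (w * x - b - s') * (w * 1))
      (fun x _ => ?_) (fun x hx => ?_) fun x hx => ?_
    · have hd (s : ℝ) : HasDerivAt (fun x => ψ (w * x - b - s))
          (deriv ψ (w * x - b - s) * (w * 1)) x :=
        ((hψ.differentiable one_ne_zero _).hasDerivAt).comp x
          ((((hasDerivAt_id x).const_mul w).sub_const b).sub_const s)
      exact (hd s).sub (hd s')
    · rw [← sub_mul, abs_mul, mul_one]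
      have := (h₂ _ (hmem x hx s hs) _ (hmem x hx s' hs')
        ((hdist x).trans_lt (hlt.trans_le (min_le_right _ _)))).le
      calc _ ≤ ε / (|w| + 1) * |w| := mul_le_mul_of_nonneg_right this (abs_nonneg _)
        _ ≤ ε := by
          rw [div_mul_eq_mul_div, div_le_iff₀ (by positivity)]
          nlinarith [abs_nonneg w]
    · exact (h₁ _ (hmem x hx s hs) _ (hmem x hx s' hs')
        ((hdist x).trans_lt (hlt.trans_le (min_le_left _ _)))).le

open scoped Convolution in
/-- Mollifications of `ψ` are smooth and lie in the closure. If the `k`-th derivative of all of them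
vanished identically, they would be polynomials of degree less than `k`, and so would their limit `ψ`;
otherwise a translate of one has a nonzero `k`-th derivative at `0`, which gives `x ^ k`. -/
theorem pow_mem_lipClosure_of_contDiff {ψ : ℝ → ℝ} (hψ : ContDiff ℝ 1 ψ)
    (hpoly : ¬ ∃ Q : Polynomial ℝ, ∀ x, ψ x = Q.eval x) {R : ℝ} (hR : 0 < R) (k : ℕ) :
    (fun x : ℝ => x ^ k) ∈ lipClosure (Set.Icc (-R) R) (ridgeSpan ℝ ψ) := by
  induction k using Nat.strong_induction_on with
  | _ k ih =>
  let φ (i : ℕ) : ContDiffBump (0 : ℝ) :=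
    ⟨1 / ((i : ℝ) + 1) / 2, 1 / ((i : ℝ) + 1), by positivity, half_lt_self (by positivity)⟩
  have hφ : Tendsto (fun i => (φ i).rOut) atTop (𝓝 0) := tendsto_one_div_add_atTop_nhds_zero_nat
  let g (i : ℕ) : ℝ → ℝ := (φ i).normed volume ⋆[ContinuousLinearMap.lsmul ℝ ℝ, volume] ψ
  have hg (i : ℕ) : ContDiff ℝ k (g i) :=
    (φ i).hasCompactSupport_normed.contDiff_convolution_left (n := (k : ℕ∞)) _
      (φ i).contDiff_normed hψ.continuous.locallyIntegrable
  have hlim (x : ℝ) : Tendsto (fun i => g i x) atTop (𝓝 (ψ x)) :=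
    ContDiffBump.convolution_tendsto_right_of_continuous hφ hψ.continuous x
  have hmem (i : ℕ) (w b : ℝ) :
      (fun x => g i (w * x - b)) ∈ lipClosure (Set.Icc (-R) R) (ridgeSpan ℝ ψ) := by
    have h := integral_comp_mem_lipClosure hψ ((φ i).continuous_normed (μ := volume))
      (φ i).rOut_pos (R := R) w b
    convert h using 2 with x
    rw [intervalIntegral.integral_eq_integral_of_support_subset]
    · rfl
    · refine (Function.support_mul_subset_left _ _).trans ?_
      rw [(φ i).support_normed_eq, Real.ball_eq_Ioo, zero_sub, zero_add]
      exact Set.Ioo_subset_Ioc_self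
  by_cases h : ∃ i c, iteratedDeriv k (g i) c ≠ 0
  · obtain ⟨i, c, hc⟩ := h
    refine pow_mem_lipClosure_of_iteratedDeriv_ne_zero hR (f := fun x => g i (x + c))
      ((hg i).comp (by fun_prop)) (fun w => ?_) ih ?_
    · simpa using hmem i w (-c)
    · rw [iteratedDeriv_comp_add_const]
      simpa using hc
  · push Not at h
    choose p hp hgp using fun i => exists_polynomial_of_iteratedDeriv_eq_zero (hg i) (h i)
    refine (hpoly (exists_polynomial_of_tendsto hp fun x => ?_)).elim
    simpa only [hgp] using hlim x

theorem cos_mem_lipClosure {ψ : ℝ → ℝ} (hψ : (∀ x, ψ x = max x 0) ∨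
      (ContDiff ℝ 1 ψ ∧ ¬ ∃ Q : Polynomial ℝ, ∀ x, ψ x = Q.eval x)) {R : ℝ} (hR : 0 < R) :
    Real.cos ∈ lipClosure (Set.Icc (-R) R) (ridgeSpan ℝ ψ) := by
  rcases hψ with hψ | ⟨hψ, hpoly⟩
  · exact cos_mem_lipClosure_relu hψ hR
  · exact cos_mem_lipClosure_of_pow_mem hR (pow_mem_lipClosure_of_contDiff hψ hpoly hR)

/-- The one-dimensional approximation of the cosine carries over to ridge functions in any
dimension. -/
theorem ridgeSpan_cos_le_lipClosure {E : Type*} [NormedAddCommGroup E] [InnerProductSpace ℝ E]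
    {ψ : ℝ → ℝ} (hψ : (∀ x, ψ x = max x 0) ∨
      (ContDiff ℝ 1 ψ ∧ ¬ ∃ Q : Polynomial ℝ, ∀ x, ψ x = Q.eval x)) {S : Set E}
    (hS : Bornology.IsBounded S) : ridgeSpan E Real.cos ≤ lipClosure S (ridgeSpan E ψ) := by
  refine Submodule.span_le.2 ?_
  rintro _ ⟨⟨w, b⟩, rfl⟩
  obtain ⟨C, hC⟩ := hS.exists_norm_le
  set R := ‖w‖ * |C| + |b| + 1 with hRdef
  have hR : 0 < R := by positivity
  have hmem (x) (hx : x ∈ S) : inner ℝ w x - b ∈ Set.Icc (-R) R := by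
    refine abs_le.1 ((abs_sub _ _).trans ?_)
    have h1 := abs_real_inner_le_norm w x
    have h2 : ‖w‖ * ‖x‖ ≤ ‖w‖ * |C| :=
      mul_le_mul_of_nonneg_left ((hC x hx).trans (le_abs_self C)) (norm_nonneg w)
    linarith
  intro ε hε
  obtain ⟨h, hh, hsmall⟩ := cos_mem_lipClosure hψ hR (ε / (‖w‖ + 1)) (by positivity)
  refine ⟨fun x => h (inner ℝ w x - b), ?_, fun x hx y hy => ?_, fun x hx => ?_⟩
  · -- composing with an affine functional maps one-dimensional ridge sums to ridge sums
    have hmap : ridgeSpan ℝ ψ ≤ (ridgeSpan E ψ).comap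
        (LinearMap.funLeft ℝ ℝ fun x : E => inner ℝ w x - b) := by
      refine Submodule.span_le.2 ?_
      rintro _ ⟨⟨v, c⟩, rfl⟩
      refine Submodule.subset_span ⟨(v • w, v * b + c), ?_⟩
      ext x
      have hinner (t : ℝ) : inner ℝ v t = v * t := by simp [mul_comm]
      simp only [LinearMap.funLeft_apply, real_inner_smul_left, hinner]
      congr 1
      ring
    exact hmap hh
  · have h1 := hsmall.1 _ (hmem x hx) _ (hmem y hy)
    refine h1.trans ?_
    rw [sub_sub_sub_cancel_right, ← inner_sub_right]
    have h2 : ‖(inner ℝ w (x - y) : ℝ)‖ ≤ ‖w‖ * ‖x - y‖ := abs_real_inner_le_norm _ _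
    calc _ ≤ ε / (‖w‖ + 1) * (‖w‖ * ‖x - y‖) := by gcongr
      _ = ε * (‖w‖ / (‖w‖ + 1)) * ‖x - y‖ := by ring
      _ ≤ ε * 1 * ‖x - y‖ := by
        gcongr
        exact (div_le_one (by positivity)).2 (by linarith)
      _ = ε * ‖x - y‖ := by rw [mul_one]
  · refine (hsmall.2 _ (hmem x hx)).trans (div_le_self hε.le ?_)
    linarith [norm_nonneg w]

/-! ### Lipschitz functions on a box as sums of cosines -/

section Torus

variable {ι : Type*}

/-- The projection of `ℝ^ι` to the torus whose periods are twice the side lengths of the box with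
corners `lo` and `hi`. -/
noncomputable def boxToTorus (lo hi : ι → ℝ) (x : EuclideanSpace ℝ ι) : UnitAddTorus ι :=
  fun j => (((x j - lo j) / (2 * (hi j - lo j)) : ℝ) : UnitAddCircle)

/-- The map folding the torus onto the box with corners `lo` and `hi`; it is a left inverse of
`boxToTorus` on the box. -/
noncomputable def torusToBox (lo hi : ι → ℝ) (y : UnitAddTorus ι) : EuclideanSpace ℝ ι :=
  WithLp.toLp 2 fun j => lo j + 2 * (hi j - lo j) * ‖y j‖

theorem torusToBox_apply (lo hi : ι → ℝ) (y : UnitAddTorus ι) (j : ι) :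
    torusToBox lo hi y j = lo j + 2 * (hi j - lo j) * ‖y j‖ := rfl

theorem continuous_torusToBox (lo hi : ι → ℝ) : Continuous (torusToBox lo hi) := by
  unfold torusToBox
  refine (PiLp.continuous_toLp 2 _).comp ?_
  fun_prop

theorem torusToBox_mem {lo hi : ι → ℝ} (hlt : ∀ j, lo j < hi j) (y : UnitAddTorus ι) (j : ι) :
    torusToBox lo hi y j ∈ Set.Icc (lo j) (hi j) := by
  have h1 := AddCircle.norm_le_half_period (1 : ℝ) (x := y j) one_ne_zero
  rw [abs_one] at h1
  have h2 := sub_pos.2 (hlt j)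
  rw [torusToBox_apply]
  constructor
  · nlinarith [norm_nonneg (y j)]
  · nlinarith

theorem torusToBox_boxToTorus {lo hi : ι → ℝ} (hlt : ∀ j, lo j < hi j) {x : EuclideanSpace ℝ ι}
    (hx : ∀ j, x j ∈ Set.Icc (lo j) (hi j)) : torusToBox lo hi (boxToTorus lo hi x) = x := by
  ext j
  have h2 := sub_pos.2 (hlt j)
  have h3 : 0 ≤ (x j - lo j) / (2 * (hi j - lo j)) :=
    div_nonneg (by linarith [(hx j).1]) (by linarith)
  have h4 : (x j - lo j) / (2 * (hi j - lo j)) ≤ 1 / 2 := by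
    rw [div_le_div_iff₀ (by linarith) two_pos]
    linarith [(hx j).2]
  rw [torusToBox_apply, boxToTorus, (AddCircle.norm_coe_eq_abs_iff (1 : ℝ) one_ne_zero).2
    (by rwa [abs_of_nonneg h3, abs_one]), abs_of_nonneg h3, mul_div_cancel₀ _ (by positivity)]
  ring

/-- Folding back a translate of the projection to the torus does not increase distances. -/
theorem norm_torusToBox_sub_le [Fintype ι] {lo hi : ι → ℝ} (hlt : ∀ j, lo j < hi j)
    (x x' : EuclideanSpace ℝ ι) (y : UnitAddTorus ι) :
    ‖torusToBox lo hi (boxToTorus lo hi x - y) - torusToBox lo hi (boxToTorus lo hi x' - y)‖ ≤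
      ‖x - x'‖ := by
  rw [EuclideanSpace.norm_eq, EuclideanSpace.norm_eq]
  refine Real.sqrt_le_sqrt (Finset.sum_le_sum fun j _ => ?_)
  refine pow_le_pow_left₀ (norm_nonneg _) ?_ 2
  have h2 : 0 < 2 * (hi j - lo j) := by linarith [hlt j]
  have h3 : |‖(boxToTorus lo hi x - y) j‖ - ‖(boxToTorus lo hi x' - y) j‖| ≤
      |x j - x' j| / (2 * (hi j - lo j)) := by
    refine (abs_norm_sub_norm_le _ _).trans ?_
    have h4 : (boxToTorus lo hi x - y) j - (boxToTorus lo hi x' - y) j =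
        (((x j - x' j) / (2 * (hi j - lo j)) : ℝ) : UnitAddCircle) := by
      rw [Pi.sub_apply, Pi.sub_apply, sub_sub_sub_cancel_right, boxToTorus, boxToTorus,
        ← AddCircle.coe_sub, ← sub_div, sub_sub_sub_cancel_right]
    rw [h4, UnitAddCircle.norm_eq, ← abs_of_pos h2, ← abs_div, abs_of_pos h2]
    simpa using round_le ((x j - x' j) / (2 * (hi j - lo j))) 0
  rw [PiLp.sub_apply, PiLp.sub_apply, torusToBox_apply, torusToBox_apply, add_sub_add_left_eq_sub,
    ← mul_sub, norm_mul, Real.norm_eq_abs, Real.norm_eq_abs, Real.norm_eq_abs, abs_of_pos h2]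
  calc _ ≤ 2 * (hi j - lo j) * (|x j - x' j| / (2 * (hi j - lo j))) := by gcongr
    _ = |x j - x' j| := mul_div_cancel₀ _ h2.ne'

/-- Read on the box, the characters of the torus are complex exponentials of affine functions; this is
where ridge functions come from. -/
theorem mFourier_boxToTorus [Fintype ι] (lo hi : ι → ℝ) (m : ι → ℤ) :
    ∃ (w : EuclideanSpace ℝ ι) (b : ℝ),
    ∀ x, UnitAddTorus.mFourier m (boxToTorus lo hi x) =
      Complex.exp (((inner ℝ w x - b : ℝ) : ℂ) * Complex.I) := by
  refine ⟨WithLp.toLp 2 fun j => 2 * Real.pi * m j / (2 * (hi j - lo j)),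
    ∑ j, 2 * Real.pi * m j / (2 * (hi j - lo j)) * lo j, fun x => ?_⟩
  simp only [UnitAddTorus.mFourier, ContinuousMap.coe_mk, boxToTorus, fourier_coe_apply,
    ← Complex.exp_sum]
  congr 1
  rw [PiLp.inner_apply, ← Finset.sum_sub_distrib, Complex.ofReal_sum, Finset.sum_mul]
  refine Finset.sum_congr rfl fun j _ => ?_
  simp
  ring

/-- The convolution of a continuous function on the torus with a trigonometric polynomial is a
trigonometric polynomial, hence a ridge sum for the cosine. -/
theorem integral_mul_re_mem_ridgeSpan [Fintype ι] (lo hi : ι → ℝ) (μ : Measure (UnitAddTorus ι))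
    [IsFiniteMeasure μ] (F : C(UnitAddTorus ι, ℝ)) {p : C(UnitAddTorus ι, ℂ)}
    (hp : p ∈ Submodule.span ℂ (Set.range (UnitAddTorus.mFourier (d := ι)))) :
    (fun x => ∫ y, F y * (p (boxToTorus lo hi x - y)).re ∂μ) ∈
      ridgeSpan (EuclideanSpace ℝ ι) Real.cos := by
  suffices h : ∀ c : ℂ, (fun x => ∫ y, F y * (c * p (boxToTorus lo hi x - y)).re ∂μ) ∈
      ridgeSpan (EuclideanSpace ℝ ι) Real.cos by simpa using h 1
  have hint {f : UnitAddTorus ι → ℝ} (hf : Continuous f) : Integrable f μ :=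
    hf.integrable_of_hasCompactSupport (HasCompactSupport.of_compactSpace f)
  induction hp using Submodule.span_induction with
  | mem p hp =>
    obtain ⟨m, rfl⟩ := hp
    intro c
    obtain ⟨w, b, hwb⟩ := mFourier_boxToTorus lo hi m
    set z : ℂ := ∫ y, (F y : ℂ) * c * UnitAddTorus.mFourier (-m) y ∂μ
    have key (x) : ∫ y, F y * (c * UnitAddTorus.mFourier m (boxToTorus lo hi x - y)).re ∂μ =
        ‖z‖ * Real.cos (inner ℝ w x - (b - z.arg)) := by
      have h1 (y) : F y * (c * UnitAddTorus.mFourier m (boxToTorus lo hi x - y)).re =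
          RCLike.re (UnitAddTorus.mFourier m (boxToTorus lo hi x) *
            ((F y : ℂ) * c * UnitAddTorus.mFourier (-m) y)) := by
        have h2 : UnitAddTorus.mFourier m (boxToTorus lo hi x - y) =
            UnitAddTorus.mFourier m (boxToTorus lo hi x) * UnitAddTorus.mFourier (-m) y := by
          simp only [UnitAddTorus.mFourier, ContinuousMap.coe_mk, ← Finset.prod_mul_distrib]
          refine Finset.prod_congr rfl fun i _ => ?_
          rw [fourier_apply, fourier_apply, fourier_apply, ← Circle.coe_mul,
            ← AddCircle.toCircle_add, Pi.sub_apply, Pi.neg_apply, smul_sub, neg_smul,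
            sub_eq_add_neg]
        rw [h2, ← Complex.re_ofReal_mul]
        exact congrArg Complex.re (by ring)
      simp_rw [h1]
      rw [integral_re, integral_const_mul, hwb]
      · change (Complex.exp _ * z).re = _
        conv_lhs => rw [← Complex.norm_mul_exp_arg_mul_I z]
        rw [mul_left_comm, ← Complex.exp_add, ← add_mul, ← Complex.ofReal_add,
          Complex.re_ofReal_mul, Complex.exp_ofReal_mul_I_re]
        congr 2
        ring
      · refine Continuous.integrable_of_hasCompactSupport ?_ (HasCompactSupport.of_compactSpace _)
        fun_prop
    simp_rw [key]
    exact Submodule.smul_mem _ ‖z‖ (Submodule.subset_span ⟨(w, b - z.arg), rfl⟩)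
  | zero =>
    intro c
    convert Submodule.zero_mem _ using 1
    ext x
    simp
  | add p q _ _ hp hq =>
    intro c
    convert Submodule.add_mem _ (hp c) (hq c) using 1
    ext x
    rw [Pi.add_apply, ← integral_add]
    · simp only [ContinuousMap.add_apply, mul_add, Complex.add_re]
    · exact hint (by fun_prop)
    · exact hint (by fun_prop)
  | smul a p _ hp =>
    intro c
    simpa [mul_assoc] using hp (c * a)

/-- A Lipschitz function on a box is a uniform limit on it of ridge sums for the cosine whose
Lipschitz constants and bounds are asymptotically not worse. The function is folded onto a torus and
convolved with a trigonometric polynomial that is uniformly close to a positive kernel of mass one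
concentrated near the origin; such convolutions are averages of translates. -/
theorem exists_mem_ridgeSpan_cos [Fintype ι] {lo hi : ι → ℝ} (hlt : ∀ j, lo j < hi j)
    {f : EuclideanSpace ℝ ι → ℝ} {B L : ℝ} (hB : 0 ≤ B) (hL : 0 ≤ L)
    (hfL : ∀ x y, |f x - f y| ≤ L * ‖x - y‖)
    (hfB : ∀ x : EuclideanSpace ℝ ι, (∀ j, x j ∈ Set.Icc (lo j) (hi j)) → |f x| ≤ B)
    {ε : ℝ} (hε : 0 < ε) :
    ∃ g ∈ ridgeSpan (EuclideanSpace ℝ ι) Real.cos, (∀ x y, |g x - g y| ≤ L * (1 + ε) * ‖x - y‖) ∧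
      ∀ x : EuclideanSpace ℝ ι, (∀ j, x j ∈ Set.Icc (lo j) (hi j)) →
        |g x - f x| ≤ ε * (1 + B) := by
  have hfcont : Continuous f := by
    refine (LipschitzWith.of_dist_le_mul (K := ⟨L, hL⟩) fun x y => ?_).continuous
    rw [Real.dist_eq, dist_eq_norm]
    exact hfL x y
  let F : C(UnitAddTorus ι, ℝ) :=
    ⟨fun y => f (torusToBox lo hi y), hfcont.comp (continuous_torusToBox lo hi)⟩
  have hFB (y) : |F y| ≤ B := hfB _ (torusToBox_mem hlt y)
  let μ : Measure (UnitAddTorus ι) := Measure.addHaar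
  have hint {g : UnitAddTorus ι → ℝ} (hg : Continuous g) : Integrable g μ :=
    hg.integrable_of_hasCompactSupport (HasCompactSupport.of_compactSpace g)
  obtain ⟨δ, hδ, hFδ⟩ := Metric.uniformContinuous_iff.1
    (CompactSpace.uniformContinuous_of_continuous F.continuous) ε hε
  -- the positive kernel `K₀ / I₀`
  let K₀ (y : UnitAddTorus ι) : ℝ := max (δ - ‖y‖) 0
  have hK₀ : Continuous K₀ := by fun_prop
  set I₀ := ∫ y, K₀ y ∂μ
  have hI₀ : 0 < I₀ := hK₀.integral_pos_of_hasCompactSupport_nonneg_nonzero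
    (HasCompactSupport.of_compactSpace K₀) (fun y => le_max_right _ _) (x := 0)
    (by simp [K₀, hδ.ne', hδ.le])
  set m := μ.real Set.univ
  have hm : 0 ≤ m := measureReal_nonneg
  let K₁ : C(UnitAddTorus ι, ℂ) := ⟨fun y => ((K₀ y / I₀ : ℝ) : ℂ), by fun_prop⟩
  have hK₁ : K₁ ∈ (Submodule.span ℂ
      (Set.range (UnitAddTorus.mFourier (d := ι)))).topologicalClosure := by
    rw [UnitAddTorus.span_mFourier_closure_eq_top]
    trivial
  obtain ⟨p, hp, hpK⟩ := Metric.mem_closure_iff.1 hK₁ (ε / (m + 1)) (by positivity)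
  have hpK' (y) : |(p y).re - K₀ y / I₀| ≤ ε / (m + 1) := by
    have h1 : |(p y - K₁ y).re| ≤ ‖p y - K₁ y‖ := Complex.abs_re_le_norm _
    have h2 : dist (K₁ y) (p y) ≤ dist K₁ p := ContinuousMap.dist_apply_le_dist y
    rw [dist_comm, dist_eq_norm] at h2
    have h3 : (p y - K₁ y).re = (p y).re - K₀ y / I₀ := by simp [K₁]
    rw [← h3]
    exact h1.trans (h2.trans hpK.le)
  have hm' : m * (ε / (m + 1)) ≤ ε := by
    rw [mul_div_assoc', div_le_iff₀ (by positivity)]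
    nlinarith
  have hpc : Continuous fun y => (p y).re := Complex.continuous_re.comp p.continuous
  have hK₀I : ∫ y, K₀ y / I₀ ∂μ = 1 := by
    rw [integral_div, div_self hI₀.ne']
  have hdiff : ∫ y, |(p y).re - K₀ y / I₀| ∂μ ≤ ε := by
    refine le_trans (integral_mono (hint (by fun_prop)) (integrable_const (ε / (m + 1))) hpK') ?_
    rw [integral_const, smul_eq_mul]
    exact hm'
  have hmass : ∫ y, |(p y).re| ∂μ ≤ 1 + ε := by
    have h1 (y) : |(p y).re| ≤ K₀ y / I₀ + |(p y).re - K₀ y / I₀| := by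
      have h2 : 0 ≤ K₀ y / I₀ := div_nonneg (le_max_right _ _) hI₀.le
      have h3 := abs_add_le (K₀ y / I₀) ((p y).re - K₀ y / I₀)
      rw [add_sub_cancel, abs_of_nonneg h2] at h3
      exact h3
    refine (integral_mono (hint (by fun_prop)) (hint (by fun_prop)) h1).trans ?_
    rw [integral_add (hint (by fun_prop)) (hint (by fun_prop)), hK₀I]
    linarith
  have hconv (x) : ∫ y, F y * (p (boxToTorus lo hi x - y)).re ∂μ =
      ∫ y, F (boxToTorus lo hi x - y) * (p y).re ∂μ := by
    rw [← integral_sub_left_eq_self _ μ (boxToTorus lo hi x)]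
    simp only [sub_sub_cancel]
  have hFp (x) : Integrable (fun y => F (boxToTorus lo hi x - y) * (p y).re) μ :=
    hint (by fun_prop)
  refine ⟨_, integral_mul_re_mem_ridgeSpan lo hi μ F hp, fun x x' => ?_, fun x hx => ?_⟩
  · rw [hconv, hconv, ← integral_sub (hFp x) (hFp x')]
    have h1 (y) : ‖F (boxToTorus lo hi x - y) * (p y).re - F (boxToTorus lo hi x' - y) * (p y).re‖ ≤
        L * ‖x - x'‖ * |(p y).re| := by
      rw [← sub_mul, norm_mul, Real.norm_eq_abs, Real.norm_eq_abs]
      refine mul_le_mul_of_nonneg_right ((hfL _ _).trans ?_) (abs_nonneg _)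
      exact mul_le_mul_of_nonneg_left (norm_torusToBox_sub_le hlt x x' y) hL
    rw [← Real.norm_eq_abs]
    refine (norm_integral_le_of_norm_le (hint (by fun_prop)) (Eventually.of_forall h1)).trans ?_
    rw [integral_const_mul, mul_right_comm L]
    gcongr
  · have hfx : f x = ∫ y, f x * (K₀ y / I₀) ∂μ := by rw [integral_const_mul, hK₀I, mul_one]
    rw [hconv]
    conv_lhs => rw [hfx]
    have hfK : Integrable (fun y => f x * (K₀ y / I₀)) μ := hint (by fun_prop)
    rw [← integral_sub (hFp x) hfK, ← Real.norm_eq_abs]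
    have hFx : F (boxToTorus lo hi x) = f x := congrArg f (torusToBox_boxToTorus hlt hx)
    have h1 (y) : ‖F (boxToTorus lo hi x - y) * (p y).re - f x * (K₀ y / I₀)‖ ≤
        B * |(p y).re - K₀ y / I₀| + ε * (K₀ y / I₀) := by
      have h2 : F (boxToTorus lo hi x - y) * (p y).re - f x * (K₀ y / I₀) =
          F (boxToTorus lo hi x - y) * ((p y).re - K₀ y / I₀) +
            (F (boxToTorus lo hi x - y) - f x) * (K₀ y / I₀) := by ring
      rw [h2]
      refine (norm_add_le _ _).trans (add_le_add ?_ ?_)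
      · rw [norm_mul]
        exact mul_le_mul_of_nonneg_right (hFB _) (abs_nonneg _)
      · have h3 : 0 ≤ K₀ y / I₀ := div_nonneg (le_max_right _ _) hI₀.le
        rw [norm_mul, Real.norm_of_nonneg h3]
        rcases lt_or_ge ‖y‖ δ with hy | hy
        · refine mul_le_mul_of_nonneg_right ?_ h3
          have h4 := @hFδ (boxToTorus lo hi x - y) (boxToTorus lo hi x) (by
            rw [dist_eq_norm, sub_sub_cancel_left, norm_neg]
            exact hy)
          rw [Real.dist_eq, hFx] at h4
          exact h4.le
        · have h4 : K₀ y = 0 := max_eq_right (by linarith)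
          simp [h4]
    refine (norm_integral_le_of_norm_le (hint (by fun_prop)) (Eventually.of_forall h1)).trans ?_
    rw [integral_add (hint (by fun_prop)) (hint (by fun_prop)), integral_const_mul,
      integral_const_mul, hK₀I]
    nlinarith

end Torus

/-! ### Density of ridge strategies -/

/-- A function all of whose components lie in `ridgeSpan` is a ridge combination with vector
coefficients: the parameters used by the components are collected in one finite list. -/
theorem isRidge_of_forall_mem_ridgeSpan {ι : Type*} [Fintype ι] {d : ℕ} {ψ : ℝ → ℝ}
    {f : EuclideanSpace ℝ ι → Fin d → ℝ}
    (hf : ∀ l, (fun x => f x l) ∈ ridgeSpan (EuclideanSpace ℝ ι) ψ) : IsRidge ψ f := by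
  classical
  choose c hc using fun l => Finsupp.mem_span_range_iff_exists_finsupp.1 (hf l)
  let T : Finset (EuclideanSpace ℝ ι × ℝ) := Finset.univ.biUnion fun l => (c l).support
  refine ⟨T.card, fun m l => c l (T.equivFin.symm m), fun m => (T.equivFin.symm m).1.1,
    fun m => (T.equivFin.symm m).1.2, fun x l => ?_⟩
  have h1 : f x l = ∑ p ∈ T, c l p * ψ (inner ℝ p.1 x - p.2) := by
    rw [← congrFun (hc l) x, Finsupp.sum, Finset.sum_apply]
    refine Finset.sum_subset (fun p hp => ?_) fun p _ hp => ?_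
    · exact Finset.mem_biUnion.2 ⟨l, Finset.mem_univ _, hp⟩
    · simp [Finsupp.notMem_support_iff.1 hp]
  rw [h1, ← Finset.sum_coe_sort T, ← T.equivFin.symm.sum_comp]

/-- Ridge sums approximate a bounded Lipschitz function on a box under the same bound and the same
Lipschitz constant. The slight excess of the approximants in both is removed by scaling. -/
theorem exists_mem_ridgeSpan_near {ι : Type*} [Fintype ι] {ψ : ℝ → ℝ}
    (hψ : (∀ x, ψ x = max x 0) ∨
      (ContDiff ℝ 1 ψ ∧ ¬ ∃ Q : Polynomial ℝ, ∀ x, ψ x = Q.eval x))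
    {lo hi : ι → ℝ} (hlt : ∀ j, lo j < hi j) {S : Set (EuclideanSpace ℝ ι)}
    (hS : ∀ x, x ∈ S ↔ ∀ j, x j ∈ Set.Icc (lo j) (hi j)) (hSb : Bornology.IsBounded S)
    {f : EuclideanSpace ℝ ι → ℝ} {B L : ℝ} (hB : 0 < B) (hL : 0 < L)
    (hfL : ∀ x y, |f x - f y| ≤ L * ‖x - y‖) (hfB : ∀ x ∈ S, |f x| ≤ B) {η : ℝ} (hη : 0 < η) :
    ∃ h ∈ ridgeSpan (EuclideanSpace ℝ ι) ψ, (∀ x ∈ S, ∀ y ∈ S, |h x - h y| ≤ L * ‖x - y‖) ∧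
      (∀ x ∈ S, |h x| ≤ B) ∧ ∀ x ∈ S, |h x - f x| ≤ η := by
  -- `A` bounds the relative excess of the approximants per unit of `ε`
  set A := 2 + B + 1 / L + 2 / B with hA
  have hA0 : 0 < A := by positivity
  obtain ⟨ε, hε, hεη⟩ : ∃ ε > 0, ε * (2 + B + A * B) ≤ η :=
    ⟨η / (2 + B + A * B), by positivity, (div_mul_cancel₀ _ (by positivity)).le⟩
  obtain ⟨g, hg, hgL, hgf⟩ := exists_mem_ridgeSpan_cos hlt hB.le hL.le hfL
    (fun x hx => hfB x ((hS x).2 hx)) hε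
  obtain ⟨h, hh, hLip, hsup⟩ := ridgeSpan_cos_le_lipClosure hψ hSb hg ε hε
  have hhL (x) (hx : x ∈ S) (y) (hy : y ∈ S) : |h x - h y| ≤ L * (1 + ε * A) * ‖x - y‖ := by
    have h1 := hLip x hx y hy
    have h2 := hgL x y
    simp only [Pi.sub_apply] at h1
    have h3 : |h x - h y| ≤ |g x - g y| + |(g x - h x) - (g y - h y)| := by
      have := abs_sub (g x - g y) ((g x - h x) - (g y - h y))
      rwa [show g x - g y - ((g x - h x) - (g y - h y)) = h x - h y by ring] at this
    have h4 : L * (1 + ε) + ε ≤ L * (1 + ε * A) := by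
      have : L * A = L * (2 + B) + 1 + L * (2 / B) := by rw [hA]; field_simp
      have h5 : 0 ≤ L * (2 / B) := by positivity
      nlinarith [mul_pos hL hB, mul_pos hε hL]
    calc _ ≤ (L * (1 + ε) + ε) * ‖x - y‖ := by linarith
      _ ≤ _ := mul_le_mul_of_nonneg_right h4 (norm_nonneg _)
  have hhf (x) (hx : x ∈ S) : |h x - f x| ≤ ε * (2 + B) := by
    have h1 := hsup x hx
    have h2 := hgf x ((hS x).1 hx)
    have h3 := abs_sub (g x - f x) (g x - h x)
    rw [sub_sub_sub_cancel_left] at h3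
    simp only [Pi.sub_apply] at h1
    linarith
  have hhB (x) (hx : x ∈ S) : |h x| ≤ B * (1 + ε * A) := by
    have h1 := hhf x hx
    have h2 := hfB x hx
    have h3 := abs_add_le (h x - f x) (f x)
    rw [sub_add_cancel] at h3
    have h4 : B * A = 2 * B + B * B + B / L + 2 := by rw [hA]; field_simp
    have h5 : 0 ≤ B / L := by positivity
    nlinarith [mul_pos hε hB, mul_pos hε (mul_pos hB hB), mul_nonneg hε.le h5]
  set r := (1 + ε * A)⁻¹ with hr
  have hD : 0 < 1 + ε * A := by positivity
  have hr0 : 0 < r := inv_pos.2 hD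
  have hrD : r * (1 + ε * A) = 1 := inv_mul_cancel₀ hD.ne'
  refine ⟨r • h, Submodule.smul_mem _ r hh, fun x hx y hy => ?_, fun x hx => ?_, fun x hx => ?_⟩
  · rw [Pi.smul_apply, Pi.smul_apply, ← smul_sub, smul_eq_mul, abs_mul, abs_of_pos hr0]
    calc _ ≤ r * (L * (1 + ε * A) * ‖x - y‖) := by gcongr; exact hhL x hx y hy
      _ = (r * (1 + ε * A)) * (L * ‖x - y‖) := by ring
      _ = L * ‖x - y‖ := by rw [hrD, one_mul]
  · rw [Pi.smul_apply, smul_eq_mul, abs_mul, abs_of_pos hr0]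
    calc _ ≤ r * (B * (1 + ε * A)) := by gcongr; exact hhB x hx
      _ = (r * (1 + ε * A)) * B := by ring
      _ = B := by rw [hrD, one_mul]
  · have h1 : r * h x - h x = -(r * (ε * A)) * h x := by
      have : r = 1 - r * (ε * A) := by linarith
      linear_combination h x * this
    have h2 : |r * h x - h x| ≤ ε * A * B := by
      rw [h1, abs_mul, abs_neg, abs_of_pos (by positivity)]
      calc _ ≤ r * (ε * A) * (B * (1 + ε * A)) := by gcongr; exact hhB x hx
        _ = (r * (1 + ε * A)) * (ε * A * B) := by ring
        _ = ε * A * B := by rw [hrD, one_mul]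
    have h3 := abs_add_le (r * h x - h x) (h x - f x)
    rw [sub_add_sub_cancel] at h3
    rw [Pi.smul_apply, smul_eq_mul]
    linarith [hhf x hx]

namespace Market

variable {n a : ℕ} (M : Market n a)

/-- Strategies with ridge positions are dense among the admissible ones. -/
theorem exists_seq_admissibleRidge {ψ : ℝ → ℝ} (hψ : (∀ x, ψ x = max x 0) ∨
      (ContDiff ℝ 1 ψ ∧ ¬ ∃ Q : Polynomial ℝ, ∀ x, ψ x = Q.eval x))
    {B L : ℝ} (hB : 0 < B) (hL : 0 < L) {s : ℝ × Strategy n a} (hs : s ∈ M.admissible B L) :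
    ∃ u : ℕ → ℝ × Strategy n a, (∀ m, u m ∈ M.admissibleRidge ψ B L) ∧ (∀ m, (u m).1 = s.1) ∧
      TendstoUniformly (fun m => M.payoff (u m)) (M.payoff s) atTop := by
  have key (m : ℕ) (i : Fin n) (j : Fin a) := exists_mem_ridgeSpan_near hψ
    (lo := fun q : Fin i × Fin a => M.lo q.2) (hi := fun q => M.hi q.2) (fun q => M.lo_lt_hi q.2)
    (S := M.historyBox i) (fun x => Iff.rfl) (M.isCompact_historyBox i).isBounded hB hL
    (hs.2 i j).1 (hs.2 i j).2 (η := 1 / ((m : ℝ) + 1)) (by positivity)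
  choose h hmem hLip hbd hnear using key
  have hext (m : ℕ) (i : Fin n) (j : Fin a) : ∃ g : EuclideanSpace ℝ (Fin i × Fin a) → ℝ,
      LipschitzWith ⟨L, hL.le⟩ g ∧ Set.EqOn (h m i j) g (M.historyBox i) := by
    refine LipschitzOnWith.extend_real (LipschitzOnWith.of_dist_le_mul fun x hx y hy => ?_)
    rw [Real.dist_eq, dist_eq_norm]
    exact hLip m i j x hx y hy
  choose g hg hgh using hext
  refine ⟨fun m => (s.1, g m), fun m => ⟨⟨hs.1, fun i j => ⟨fun x y => ?_, fun x hx => ?_⟩⟩,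
    fun i _ => ⟨fun x j => h m i j x, ⟨isRidge_of_forall_mem_ridgeSpan (hmem m i),
      fun j => ⟨hLip m i j, hbd m i j⟩⟩, fun x hx j => (hgh m i j hx).symm⟩⟩, fun m => rfl, ?_⟩
  · have := (hg m i j).dist_le_mul x y
    rwa [Real.dist_eq, dist_eq_norm] at this
  · have := hbd m i j x hx
    rwa [hgh m i j hx] at this
  · refine M.tendstoUniformly_payoff tendsto_const_nhds
      (fun i j => (M.lipschitzWith_of_mem_admissible hL.le hs i j).continuous.continuousOn)
      fun i j => Metric.tendstoUniformlyOn_iff.2 fun ε hε => ?_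
    obtain ⟨N, hN⟩ := exists_nat_one_div_lt hε
    filter_upwards [eventually_ge_atTop N] with m hm x hx
    rw [dist_comm, Real.dist_eq, ← hgh m i j hx]
    refine ((hnear m i j x hx).trans ?_).trans_lt hN
    gcongr

end Market

/-! ### The penalized functionals -/

namespace Market

variable {n a : ℕ} (M : Market n a)

/-- The penalty `∑_P ∫ β (E_P[Φ - w_{c,Δ} | 𝒢]) dP`. -/
noncomputable def penalty (Ps : Finset (Measure M.Path)) (β : ℝ → ℝ) (Φ : M.Path → ℝ)
    (𝒢 : MeasurableSpace M.Path) (s : ℝ × Strategy n a) : ℝ :=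
  ∑ P ∈ Ps, ∫ ω, β ((P[Φ - M.payoff s | 𝒢]) ω) ∂P

theorem objective_eq (Ps : Finset (Measure M.Path)) (β : ℝ → ℝ) (k : ℕ) (Φ : M.Path → ℝ)
    (𝒢 : MeasurableSpace M.Path) (s : ℝ × Strategy n a) :
    M.objective Ps β k Φ 𝒢 s = s.1 + k * M.penalty Ps β Φ 𝒢 s := rfl

theorem continuous_payoff_of_mem_admissible {B L : ℝ} (hL : 0 ≤ L) {s : ℝ × Strategy n a}
    (hs : s ∈ M.admissible B L) : Continuous (M.payoff s) :=
  M.continuous_payoff fun i j =>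
    (M.lipschitzWith_of_mem_admissible hL hs i j).continuous.continuousOn

theorem zero_mem_admissible {B L : ℝ} (hB : 0 ≤ B) (hL : 0 ≤ L) :
    (0 : ℝ × Strategy n a) ∈ M.admissible B L := by
  refine ⟨by simpa using hB, fun i j => ⟨fun x y => ?_, fun x _ => by simpa using hB⟩⟩
  simpa using mul_nonneg hL (norm_nonneg _)

theorem exists_abs_sub_payoff_le {B R L : ℝ} (hL : 0 ≤ L) {s : ℝ × Strategy n a}
    (hs : s ∈ M.admissible B L) {Φ : M.Path → ℝ} (hΦR : ∀ ω, |Φ ω| ≤ R) :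
    ∃ C, ∀ ω, |(Φ - M.payoff s) ω| ≤ C := by
  obtain ⟨C, hC⟩ := isCompact_univ.exists_bound_of_continuousOn
    (M.continuous_payoff_of_mem_admissible hL hs).continuousOn
  exact ⟨R + C, fun ω => (abs_sub _ _).trans (add_le_add (hΦR ω) (hC ω trivial))⟩

theorem integrable_sub_payoff {B R L : ℝ} (hL : 0 ≤ L) {s : ℝ × Strategy n a}
    (hs : s ∈ M.admissible B L) {Φ : M.Path → ℝ} (hΦ : Measurable Φ) (hΦR : ∀ ω, |Φ ω| ≤ R)
    (P : Measure M.Path) [IsFiniteMeasure P] : Integrable (Φ - M.payoff s) P := by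
  obtain ⟨C, hC⟩ := M.exists_abs_sub_payoff_le hL hs hΦR
  exact Integrable.of_bound
    (hΦ.sub (M.continuous_payoff_of_mem_admissible hL hs).measurable).aestronglyMeasurable C
    (Eventually.of_forall hC)

theorem tendsto_penalty {Ps : Finset (Measure M.Path)} (hPs : ∀ P ∈ Ps, IsProbabilityMeasure P)
    {β : ℝ → ℝ} (hβ : Continuous β) {B R L : ℝ} (hL : 0 ≤ L) {Φ : M.Path → ℝ} (hΦ : Measurable Φ)
    (hΦR : ∀ ω, |Φ ω| ≤ R) (ℱ : Filtration ℕ (MeasurableSpace.pi : MeasurableSpace M.Path))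
    {ns : ℕ → ℕ} (hns : Tendsto ns atTop atTop) {s : ℕ → ℝ × Strategy n a}
    {t : ℝ × Strategy n a} (hs : ∀ m, s m ∈ M.admissible B L) (ht : t ∈ M.admissible B L)
    (hst : TendstoUniformly (fun m => M.payoff (s m)) (M.payoff t) atTop) :
    Tendsto (fun m => M.penalty Ps β Φ (ℱ (ns m)) (s m)) atTop
      (𝓝 (M.penalty Ps β Φ (⨆ i, ℱ i) t)) := by
  obtain ⟨C, hC⟩ := M.exists_abs_sub_payoff_le hL ht hΦR
  refine tendsto_finsetSum _ fun P hP => ?_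
  have := hPs P hP
  refine tendsto_integral_comp_condExp ℱ hns hβ
    (fun m => M.integrable_sub_payoff hL (hs m) hΦ hΦR P) (M.integrable_sub_payoff hL ht hΦ hΦR P)
    hC ?_
  refine Metric.tendstoUniformly_iff.2 fun ε hε => ?_
  filter_upwards [Metric.tendstoUniformly_iff.1 hst ε hε] with m hm ω
  simpa only [Pi.sub_apply, dist_sub_left] using hm ω

theorem tendsto_penalty_const {Ps : Finset (Measure M.Path)}
    (hPs : ∀ P ∈ Ps, IsProbabilityMeasure P) {β : ℝ → ℝ} (hβ : Continuous β) {B R L : ℝ}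
    (hL : 0 ≤ L) {Φ : M.Path → ℝ} (hΦ : Measurable Φ) (hΦR : ∀ ω, |Φ ω| ≤ R)
    {s : ℕ → ℝ × Strategy n a} {t : ℝ × Strategy n a} (hs : ∀ m, s m ∈ M.admissible B L)
    (ht : t ∈ M.admissible B L) {𝒢 : MeasurableSpace M.Path} (h𝒢 : 𝒢 ≤ MeasurableSpace.pi)
    (hst : TendstoUniformly (fun m => M.payoff (s m)) (M.payoff t) atTop) :
    Tendsto (fun m => M.penalty Ps β Φ 𝒢 (s m)) atTop (𝓝 (M.penalty Ps β Φ 𝒢 t)) := by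
  have h := M.tendsto_penalty hPs hβ hL hΦ hΦR (Filtration.const ℕ 𝒢 h𝒢) tendsto_id hs ht hst
  have h𝒢' : ⨆ i, (Filtration.const ℕ 𝒢 h𝒢) i = 𝒢 := ciSup_const
  rwa [h𝒢'] at h

theorem penalty_nonneg {Ps : Finset (Measure M.Path)} {β : ℝ → ℝ} (hβ : ∀ x, 0 ≤ β x)
    (Φ : M.Path → ℝ) (𝒢 : MeasurableSpace M.Path) (s : ℝ × Strategy n a) :
    0 ≤ M.penalty Ps β Φ 𝒢 s :=
  Finset.sum_nonneg fun _ _ => integral_nonneg fun _ => hβ _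

/-- Along a sequence of partitions that generate the terminal σ-algebra up to null sets, the penalty
converges to the penalty for the terminal σ-algebra. -/
theorem tendsto_penalty_approxSigma {Ps : Finset (Measure M.Path)}
    (hPs : ∀ P ∈ Ps, IsProbabilityMeasure P) {β : ℝ → ℝ} (hβ : Continuous β) {B R L : ℝ}
    (hL : 0 ≤ L) {Φ : M.Path → ℝ} (hΦ : Measurable Φ) (hΦR : ∀ ω, |Φ ω| ≤ R)
    {p q : ℕ → Fin a → ℝ} (hgen : M.GeneratesTerminal Ps p q)
    {ns : ℕ → ℕ} (hns : Tendsto ns atTop atTop) {s : ℕ → ℝ × Strategy n a}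
    {t : ℝ × Strategy n a} (hs : ∀ m, s m ∈ M.admissible B L) (ht : t ∈ M.admissible B L)
    (hst : TendstoUniformly (fun m => M.payoff (s m)) (M.payoff t) atTop) :
    Tendsto (fun m => M.penalty Ps β Φ (M.approxSigma p q (ns m)) (s m)) atTop
      (𝓝 (M.penalty Ps β Φ M.sigmaTerminal t)) := by
  have h := M.tendsto_penalty hPs hβ hL hΦ hΦR (M.approxFiltration p q) hns hs ht hst
  have heq : M.penalty Ps β Φ M.sigmaTerminal t =
      M.penalty Ps β Φ (⨆ i, M.approxFiltration p q i) t := by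
    refine Finset.sum_congr rfl fun P hP => integral_congr_ae ?_
    have := hPs P hP
    have hae := condExp_ae_eq_of_forall_ae_eq (μ := P) (M.limitSigma_le_sigmaTerminal p q)
      M.sigmaTerminal_le (hgen P hP) (M.integrable_sub_payoff hL ht hΦ hΦR P)
    filter_upwards [hae] with ω hω
    exact congrArg β hω.symm
  rwa [heq]

section Penalized

variable {Ps : Finset (Measure M.Path)} {β : ℝ → ℝ} {B L : ℝ} {k : ℕ} {Φ : M.Path → ℝ}

/-- The infimum in `EReal` is attained at `t` exactly when `t` minimizes the real-valued objective. -/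
theorem penalized_eq_objective_iff {𝒢 : MeasurableSpace M.Path} {t : ℝ × Strategy n a}
    (ht : t ∈ M.admissible B L) :
    M.penalized Ps β B L k Φ 𝒢 = (M.objective Ps β k Φ 𝒢 t : EReal) ↔
      ∀ s ∈ M.admissible B L, M.objective Ps β k Φ 𝒢 t ≤ M.objective Ps β k Φ 𝒢 s := by
  constructor
  · intro h s hs
    rw [← EReal.coe_le_coe_iff, ← h]
    exact iInf₂_le s hs
  · intro h
    exact le_antisymm (iInf₂_le t ht) (le_iInf₂ fun s hs => EReal.coe_le_coe_iff.2 (h s hs))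

/-- The direct method: a minimizing sequence has a uniformly convergent subsequence. -/
theorem exists_forall_objective_le (hPs : ∀ P ∈ Ps, IsProbabilityMeasure P) (hβ : Continuous β)
    (hβ0 : ∀ x, 0 ≤ β x) (hB : 0 ≤ B) (hL : 0 ≤ L) (hΦ : Measurable Φ) {R : ℝ}
    (hΦR : ∀ ω, |Φ ω| ≤ R) {𝒢 : MeasurableSpace M.Path}
    (h𝒢 : 𝒢 ≤ MeasurableSpace.pi) :
    ∃ t ∈ M.admissible B L, ∀ s ∈ M.admissible B L,
      M.objective Ps β k Φ 𝒢 t ≤ M.objective Ps β k Φ 𝒢 s := by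
  have hbdd : BddBelow (M.objective Ps β k Φ 𝒢 '' M.admissible B L) := by
    refine ⟨-B, ?_⟩
    rintro _ ⟨s, hs, rfl⟩
    have h1 := (abs_le.1 hs.1).1
    have h2 := mul_nonneg k.cast_nonneg (M.penalty_nonneg hβ0 Φ 𝒢 s (Ps := Ps))
    rw [objective_eq]
    linarith
  obtain ⟨v, -, hv, hmem⟩ := exists_seq_tendsto_sInf
    ((Set.nonempty_of_mem (M.zero_mem_admissible hB hL)).image (M.objective Ps β k Φ 𝒢)) hbdd
  choose s hs hsv using hmem
  obtain ⟨φ, hφ, t, ht, hc, hpay⟩ := M.exists_subseq_tendsto_of_admissible hL hs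
  have hlim : Tendsto (fun m => M.objective Ps β k Φ 𝒢 (s (φ m))) atTop
      (𝓝 (M.objective Ps β k Φ 𝒢 t)) :=
    hc.add ((M.tendsto_penalty_const hPs hβ hL hΦ hΦR (fun m => hs (φ m)) ht h𝒢 hpay).const_mul _)
  have heq : M.objective Ps β k Φ 𝒢 t = sInf (M.objective Ps β k Φ 𝒢 '' M.admissible B L) := by
    refine tendsto_nhds_unique hlim ?_
    simp_rw [hsv]
    exact hv.comp hφ.tendsto_atTop
  exact ⟨t, ht, fun s hs => heq ▸ csInf_le hbdd ⟨s, hs, rfl⟩⟩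

/-- Restricting to ridge positions does not change the penalized functional: the objective is
continuous and the restricted class is dense. -/
theorem penalizedRidge_eq_penalized (hPs : ∀ P ∈ Ps, IsProbabilityMeasure P) (hβ : Continuous β)
    {ψ : ℝ → ℝ} (hψ : (∀ x, ψ x = max x 0) ∨
      (ContDiff ℝ 1 ψ ∧ ¬ ∃ Q : Polynomial ℝ, ∀ x, ψ x = Q.eval x))
    (hB : 0 < B) (hL : 0 < L) (hΦ : Measurable Φ) {R : ℝ}
    (hΦR : ∀ ω, |Φ ω| ≤ R) {𝒢 : MeasurableSpace M.Path}
    (h𝒢 : 𝒢 ≤ MeasurableSpace.pi) :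
    M.penalizedRidge Ps β ψ B L k Φ 𝒢 = M.penalized Ps β B L k Φ 𝒢 := by
  refine le_antisymm (le_iInf₂ fun s hs => ?_) (le_iInf₂ fun s hs => iInf₂_le s hs.1)
  obtain ⟨u, hu, huc, hpay⟩ := M.exists_seq_admissibleRidge hψ hB hL hs
  have hlim : Tendsto (fun m => M.objective Ps β k Φ 𝒢 (u m)) atTop
      (𝓝 (M.objective Ps β k Φ 𝒢 s)) := by
    simp_rw [objective_eq, huc]
    exact ((M.tendsto_penalty_const hPs hβ hL.le hΦ hΦR (fun m => (hu m).1) hs h𝒢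
      hpay).const_mul _).const_add _
  exact ge_of_tendsto' ((continuous_coe_real_ereal.tendsto _).comp hlim) fun m =>
    iInf₂_le (u m) (hu m)

/-- Minimizers for a subsequence of the partitions have a further subsequence converging to a
minimizer for the terminal σ-algebra, with convergence of the minimal values. -/
theorem exists_subseq_minimizers_tendsto (hPs : ∀ P ∈ Ps, IsProbabilityMeasure P)
    (hβ : Continuous β) (hL : 0 ≤ L) (hΦ : Measurable Φ) {R : ℝ} (hΦR : ∀ ω, |Φ ω| ≤ R)
    {p q : ℕ → Fin a → ℝ} (hgen : M.GeneratesTerminal Ps p q) {ns : ℕ → ℕ}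
    (hns : Tendsto ns atTop atTop) {s : ℕ → ℝ × Strategy n a}
    (hs : ∀ m, s m ∈ M.admissible B L) (hmin : ∀ m, ∀ t ∈ M.admissible B L,
      M.objective Ps β k Φ (M.approxSigma p q (ns m)) (s m) ≤
        M.objective Ps β k Φ (M.approxSigma p q (ns m)) t) :
    ∃ φ : ℕ → ℕ, StrictMono φ ∧ ∃ t ∈ M.admissible B L,
      Tendsto (fun m => (s (φ m)).1) atTop (𝓝 t.1) ∧
      TendstoUniformly (fun m => M.payoff (s (φ m))) (M.payoff t) atTop ∧
      (∀ u ∈ M.admissible B L,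
        M.objective Ps β k Φ M.sigmaTerminal t ≤ M.objective Ps β k Φ M.sigmaTerminal u) ∧
      Tendsto (fun m => M.objective Ps β k Φ (M.approxSigma p q (ns (φ m))) (s (φ m))) atTop
        (𝓝 (M.objective Ps β k Φ M.sigmaTerminal t)) := by
  obtain ⟨φ, hφ, t, ht, hc, hpay⟩ := M.exists_subseq_tendsto_of_admissible hL hs
  have hns' : Tendsto (fun m => ns (φ m)) atTop atTop := hns.comp hφ.tendsto_atTop
  have hlim := hc.add ((M.tendsto_penalty_approxSigma hPs hβ hL hΦ hΦR hgen hns'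
    (fun m => hs (φ m)) ht hpay).const_mul (k : ℝ))
  refine ⟨φ, hφ, t, ht, hc, hpay, fun u hu => ?_, hlim⟩
  have hlim' := (M.tendsto_penalty_approxSigma hPs hβ hL hΦ hΦR hgen hns' (s := fun _ => u)
    (fun _ => hu) hu fun v hv => Eventually.of_forall fun _ _ =>
      refl_mem_uniformity hv).const_mul (k : ℝ) |>.const_add u.1
  exact le_of_tendsto_of_tendsto' hlim hlim' fun m => hmin (φ m) u hu

theorem tendsto_penalized_approxSigma (hPs : ∀ P ∈ Ps, IsProbabilityMeasure P)
    (hβ : Continuous β) (hβ0 : ∀ x, 0 ≤ β x) (hB : 0 ≤ B) (hL : 0 ≤ L) (hΦ : Measurable Φ) {R : ℝ}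
    (hΦR : ∀ ω, |Φ ω| ≤ R) {p q : ℕ → Fin a → ℝ} (hgen : M.GeneratesTerminal Ps p q) :
    Tendsto (fun i => M.penalized Ps β B L k Φ (M.approxSigma p q i)) atTop
      (𝓝 (M.penalized Ps β B L k Φ M.sigmaTerminal)) := by
  refine tendsto_of_subseq_tendsto fun ns hns => ?_
  choose s hs hmin using fun i => M.exists_forall_objective_le (k := k) hPs hβ hβ0 hB hL hΦ hΦR
    ((M.approxSigma_le_sigmaTerminal p q i).trans M.sigmaTerminal_le)
  obtain ⟨φ, hφ, t, ht, -, -, htmin, hlim⟩ := M.exists_subseq_minimizers_tendsto hPs hβ hL hΦ hΦR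
    hgen hns (fun m => hs (ns m)) fun m => hmin (ns m)
  refine ⟨φ, ?_⟩
  rw [(M.penalized_eq_objective_iff ht).2 htmin]
  simp_rw [fun m => (M.penalized_eq_objective_iff (hs (ns (φ m)))).2 (hmin (ns (φ m)))]
  exact (continuous_coe_real_ereal.tendsto _).comp hlim

/-- A vanishing penalty means that the strategy super-replicates conditionally on `𝒢`. -/
theorem condExp_le_condExp_payoff_of_penalty_nonpos (hPs : ∀ P ∈ Ps, IsProbabilityMeasure P)
    (hβ : Continuous β) (hβ0 : ∀ x, 0 ≤ β x) (hβ_pos : ∀ x > 0, 0 < β x) (hL : 0 ≤ L)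
    (hΦ : Measurable Φ) {R : ℝ} (hΦR : ∀ ω, |Φ ω| ≤ R) {t : ℝ × Strategy n a}
    (ht : t ∈ M.admissible B L) {P : Measure M.Path} (hP : P ∈ Ps) {𝒢 : MeasurableSpace M.Path}
    (h : M.penalty Ps β Φ 𝒢 t ≤ 0) :
    P[Φ | 𝒢] ≤ᵐ[P] P[M.payoff t | 𝒢] := by
  have := hPs P hP
  obtain ⟨C, hC⟩ := M.exists_abs_sub_payoff_le hL ht hΦR
  have hzero : ∫ ω, β ((P[Φ - M.payoff t | 𝒢]) ω) ∂P = 0 := by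
    exact (Finset.sum_eq_zero_iff_of_nonneg fun Q _ => integral_nonneg fun _ => hβ0 _).1
      (le_antisymm h (M.penalty_nonneg hβ0 Φ 𝒢 t)) P hP
  have hae := (integral_eq_zero_iff_of_nonneg (fun ω => hβ0 _)
    (integrable_comp_condExp hβ hC)).1 hzero
  have hΦi : Integrable Φ P :=
    Integrable.of_bound hΦ.aestronglyMeasurable R (Eventually.of_forall hΦR)
  have hpi : Integrable (M.payoff t) P := by
    simpa using hΦi.sub (M.integrable_sub_payoff hL ht hΦ hΦR P)
  filter_upwards [hae, condExp_sub hΦi hpi 𝒢] with ω h1 h2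
  by_contra hlt
  rw [not_le] at hlt
  refine (hβ_pos ((P[Φ - M.payoff t | 𝒢]) ω) ?_).ne' h1
  rw [h2]
  exact sub_pos.2 hlt

theorem penalty_eq_zero_of_condExp_le (hPs : ∀ P ∈ Ps, IsProbabilityMeasure P)
    (hβ_zero : ∀ x ≤ 0, β x = 0) (hL : 0 ≤ L)
    (hΦ : Measurable Φ) {R : ℝ} (hΦR : ∀ ω, |Φ ω| ≤ R) {s : ℝ × Strategy n a}
    (hs : s ∈ M.admissible B L) {𝒢 : MeasurableSpace M.Path}
    (h : ∀ P ∈ Ps, P[Φ | 𝒢] ≤ᵐ[P] P[M.payoff s | 𝒢]) :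
    M.penalty Ps β Φ 𝒢 s = 0 := by
  refine Finset.sum_eq_zero fun P hP => integral_eq_zero_of_ae ?_
  have := hPs P hP
  have hΦi : Integrable Φ P :=
    Integrable.of_bound hΦ.aestronglyMeasurable R (Eventually.of_forall hΦR)
  have hpi : Integrable (M.payoff s) P := by
    simpa using hΦi.sub (M.integrable_sub_payoff hL hs hΦ hΦR P)
  filter_upwards [h P hP, condExp_sub hΦi hpi 𝒢] with ω h1 h2
  refine hβ_zero _ ?_
  rw [h2]
  exact sub_nonpos.2 h1

/-- The penalized functionals increase to the super-replication price: as the penalty weight tends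
to infinity, limits of minimizers have vanishing penalty. -/
theorem tendsto_penalized_superRep (hPs : ∀ P ∈ Ps, IsProbabilityMeasure P) (hβ : Continuous β)
    (hβ_zero : ∀ x ≤ 0, β x = 0) (hβ_pos : ∀ x > 0, 0 < β x) (hB : 0 ≤ B) (hL : 0 ≤ L)
    (hΦ : Measurable Φ) {R : ℝ} (hΦR : ∀ ω, |Φ ω| ≤ R)
    {𝒢 : MeasurableSpace M.Path} (h𝒢 : 𝒢 ≤ MeasurableSpace.pi) :
    Tendsto (fun k : ℕ => M.penalized Ps β B L k Φ 𝒢) atTop (𝓝 (M.superRep Ps B L Φ 𝒢)) := by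
  have hβ0 (x : ℝ) : 0 ≤ β x := by
    rcases le_or_gt x 0 with h | h
    · exact (hβ_zero x h).ge
    · exact (hβ_pos x h).le
  have hpen (s) : 0 ≤ M.penalty Ps β Φ 𝒢 s := M.penalty_nonneg hβ0 Φ 𝒢 s
  have hmono : Monotone fun k : ℕ => M.penalized Ps β B L k Φ 𝒢 := by
    refine fun k l hkl => iInf₂_mono fun s _ => EReal.coe_le_coe_iff.2 ?_
    rw [objective_eq, objective_eq]
    gcongr
    exact hpen s
  choose s hs hmin using fun k => M.exists_forall_objective_le (k := k) hPs hβ hβ0 hB hL hΦ hΦR h𝒢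
  have hval (k : ℕ) := (M.penalized_eq_objective_iff (hs k)).2 (hmin k)
  have hsup : ⨆ k : ℕ, M.penalized Ps β B L k Φ 𝒢 = M.superRep Ps B L Φ 𝒢 := by
    refine le_antisymm (iSup_le fun k => le_iInf₂ fun u hu => ?_) ?_
    · refine (iInf₂_le u hu.1).trans (EReal.coe_le_coe_iff.2 ?_)
      rw [objective_eq, M.penalty_eq_zero_of_condExp_le hPs hβ_zero hL hΦ hΦR hu.1 hu.2,
        mul_zero, add_zero]
    · rcases eq_or_ne (⨆ k : ℕ, M.penalized Ps β B L k Φ 𝒢) ⊤ with htop | htop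
      · rw [htop]
        exact le_top
      have hbot : (⨆ k : ℕ, M.penalized Ps β B L k Φ 𝒢) ≠ ⊥ := by
        refine ne_bot_of_le_ne_bot ?_ (le_iSup _ 0)
        rw [hval]
        exact EReal.coe_ne_bot _
      lift (⨆ k : ℕ, M.penalized Ps β B L k Φ 𝒢) to ℝ using ⟨htop, hbot⟩ with l hl
      have hle (k : ℕ) : (s k).1 + k * M.penalty Ps β Φ 𝒢 (s k) ≤ l := by
        rw [← objective_eq, ← EReal.coe_le_coe_iff, ← hval, hl]
        exact le_iSup (fun k : ℕ => M.penalized Ps β B L k Φ 𝒢) k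
      obtain ⟨φ, hφ, t, ht, hc, hpay⟩ := M.exists_subseq_tendsto_of_admissible hL hs
      have hlim := M.tendsto_penalty_const hPs hβ hL hΦ hΦR (fun m => hs (φ m)) ht h𝒢 hpay
      have hpen0 : M.penalty Ps β Φ 𝒢 t ≤ 0 := by
        have h0 : Tendsto (fun m => (l + B) / (φ m : ℝ)) atTop (𝓝 0) :=
          tendsto_const_nhds.div_atTop (tendsto_natCast_atTop_atTop.comp hφ.tendsto_atTop)
        refine le_of_tendsto_of_tendsto hlim h0 ?_
        filter_upwards [hφ.tendsto_atTop.eventually_gt_atTop 0] with m hm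
        have hm' : (0 : ℝ) < φ m := by exact_mod_cast hm
        rw [le_div_iff₀ hm']
        linarith [hle (φ m), (abs_le.1 (hs (φ m)).1).1]
      have htl : t.1 ≤ l := le_of_tendsto' hc fun m => by
        linarith [hle (φ m), mul_nonneg (φ m).cast_nonneg (hpen (s (φ m)))]
      exact (iInf₂_le t ⟨ht, fun P hP => M.condExp_le_condExp_payoff_of_penalty_nonpos hPs hβ hβ0
        hβ_pos hL hΦ hΦR ht hP hpen0⟩).trans (EReal.coe_le_coe_iff.2 htl)
  rw [← hsup]
  exact tendsto_atTop_iSup hmono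

end Penalized

end Market



theorem mainTheorem1 {n a : ℕ} (M : Market n a)
    (Ps : Finset (Measure M.Path)) (hPs : ∀ P ∈ Ps, IsProbabilityMeasure P)
    (β : ℝ → ℝ) (hβ_cont : Continuous β) (hβ_zero : ∀ x ≤ 0, β x = 0) (hβ_pos : ∀ x > 0, 0 < β x)
    (ψ : ℝ → ℝ)
    (hψ : (∀ x, ψ x = max x 0) ∨
      (ContDiff ℝ 1 ψ ∧ ¬ ∃ Q : Polynomial ℝ, ∀ x, ψ x = Q.eval x))
    (B L : ℝ) (hB : 0 < B) (hL : 0 < L)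
    (Φ : M.Path → ℝ) (hΦ : Measurable Φ) (hΦB : ∀ ω, |Φ ω| ≤ B)
    {Ξ : Type*} [MeasurableSpace Ξ] (PU : Measure Ξ) [IsProbabilityMeasure PU]
    (p : ℕ → Fin a → Ξ → ℝ)
    (hp_unif : ∀ i j, pdf.IsUniform (p i j) (Set.Icc (M.lo j) (M.hi j)) PU volume)
    (hp_indep : iIndepFun (fun q : ℕ × Fin a => p q.1 q.2) PU) :
    -- the random partitions almost surely generate the terminal sigma-algebra
    (a = 1 → ∀ᵐ ξ ∂PU, M.sigmaTerminal = M.limitSigma (fun i j => p i j ξ) (fun _ => M.hi)) ∧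
    ((∀ P ∈ Ps, ∀ j, P {ω | (M.terminal ω j : ℝ) = M.lo j} = 0) →
      ∀ᵐ ξ ∂PU, M.GeneratesTerminal Ps (fun i j => p i j ξ) (fun _ => M.hi)) ∧
    -- for every realization of the boxes that does so
    (∀ r : ℕ → Fin a → ℝ, M.GeneratesTerminal Ps r (fun _ => M.hi) →
      (∀ k : ℕ,
        -- minimizers exist
        (∀ i, ∃ s ∈ M.admissible B L,
          M.penalized Ps β B L k Φ (M.approxSigma r (fun _ => M.hi) i)
            = (M.objective Ps β k Φ (M.approxSigma r (fun _ => M.hi) i) s : EReal)) ∧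
        (∃ s ∈ M.admissible B L,
          M.penalized Ps β B L k Φ M.sigmaTerminal
            = (M.objective Ps β k Φ M.sigmaTerminal s : EReal)) ∧
        -- minimizers converge uniformly along a subsequence, to a minimizer
        (∀ s : ℕ → ℝ × Strategy n a,
          (∀ i, s i ∈ M.admissible B L ∧
            M.penalized Ps β B L k Φ (M.approxSigma r (fun _ => M.hi) i)
              = (M.objective Ps β k Φ (M.approxSigma r (fun _ => M.hi) i) (s i) : EReal)) →
          ∃ φ : ℕ → ℕ, StrictMono φ ∧ ∃ t ∈ M.admissible B L,
            Tendsto (fun m => (s (φ m)).1) atTop (𝓝 t.1) ∧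
            TendstoUniformly (fun m => M.payoff (s (φ m))) (M.payoff t) atTop ∧
            M.penalized Ps β B L k Φ M.sigmaTerminal
              = (M.objective Ps β k Φ M.sigmaTerminal t : EReal)) ∧
        -- convergence of the penalized functionals
        Tendsto (fun i => M.penalized Ps β B L k Φ (M.approxSigma r (fun _ => M.hi) i)) atTop
          (𝓝 (M.penalized Ps β B L k Φ M.sigmaTerminal)) ∧
        Tendsto (fun i => M.penalizedRidge Ps β ψ B L k Φ (M.approxSigma r (fun _ => M.hi) i)) atTop
          (𝓝 (M.penalized Ps β B L k Φ M.sigmaTerminal))) ∧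
      Tendsto (fun k : ℕ => M.penalized Ps β B L k Φ M.sigmaTerminal) atTop
        (𝓝 (M.superRep Ps B L Φ M.sigmaTerminal))) := by

  have hβ0 (x : ℝ) : 0 ≤ β x := by
    rcases le_or_gt x 0 with h | h
    · exact (hβ_zero x h).ge
    · exact (hβ_pos x h).le
  refine ⟨fun ha => ?_, fun hnull => ?_, fun r hr => ⟨fun k => ?_, ?_⟩⟩
  · filter_upwards [M.ae_dense_of_iIndepFun_isUniform hp_unif hp_indep] with ξ hξ
    exact M.sigmaTerminal_eq_limitSigma_of_dense ha hξ
  · filter_upwards [M.ae_dense_of_iIndepFun_isUniform hp_unif hp_indep] with ξ hξ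
    exact M.generatesTerminal_of_dense hξ hnull
  · have hle (i : ℕ) : M.approxSigma r (fun _ => M.hi) i ≤ MeasurableSpace.pi :=
      (M.approxSigma_le_sigmaTerminal r _ i).trans M.sigmaTerminal_le
    have hmin {𝒢 : MeasurableSpace M.Path} (h𝒢 : 𝒢 ≤ MeasurableSpace.pi) :
        ∃ s ∈ M.admissible B L,
          M.penalized Ps β B L k Φ 𝒢 = (M.objective Ps β k Φ 𝒢 s : EReal) := by
      obtain ⟨t, ht, h⟩ := M.exists_forall_objective_le hPs hβ_cont hβ0 hB.le hL.le hΦ hΦB h𝒢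
      exact ⟨t, ht, (M.penalized_eq_objective_iff ht).2 h⟩
    have hlim := M.tendsto_penalized_approxSigma (k := k) hPs hβ_cont hβ0 hB.le hL.le hΦ hΦB hr
    refine ⟨fun i => hmin (hle i), hmin M.sigmaTerminal_le, fun s hs => ?_, hlim, ?_⟩
    · obtain ⟨φ, hφ, t, ht, hc, hpay, htmin, -⟩ := M.exists_subseq_minimizers_tendsto hPs hβ_cont
        hL.le hΦ hΦB hr tendsto_id (fun m => (hs m).1)
        fun m => (M.penalized_eq_objective_iff (hs m).1).1 (hs m).2
      exact ⟨φ, hφ, t, ht, hc, hpay, (M.penalized_eq_objective_iff ht).2 htmin⟩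
    · simp_rw [fun i => M.penalizedRidge_eq_penalized (k := k) hPs hβ_cont hψ hB hL hΦ hΦB (hle i)]
      exact hlim
  · exact M.tendsto_penalized_superRep hPs hβ_cont hβ_zero hβ_pos hB.le hL.le hΦ hΦB
      M.sigmaTerminal_le
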